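/- Let $\ell=\mathbb{R}u$, $|u|=1$, be a line through $0$ in $\mathbb{C}$, oriented by $u$, with closed half-planes $\overline{D^+}$ to its left and $\overline{D^-}$ to its right and interiors $D^{\pm}$. Let $G:\ell\setminus\{0\}\to\mathbb{C}\setminus\{0\}$ be Hölder continuous except for discontinuities of the first kind at $0$ and $\infty$: on each of the two rays of $\ell$, $G$ is Hölder continuous with respect to the chordal metric of the Riemann sphere, and the one-sided limits $$G(0\pm0)=\lim_{t\to0^{\pm}}G(tu),\qquad G(\infty-0)=\lim_{t\to+\infty}G(tu),\qquad G(\infty+0)=\lim_{t\to-\infty}G(tu)$$ are nonzero. Assume that the jumps $\Delta_0=G(0+0)-G(0-0)$ and $\Delta_\infty=G(\infty+0)-G(\infty-0)$ satisfy $\Delta_0=-\Delta_\infty$, and that $G$ has index zero, that is, the changes of a continuous argument of $G$ along the two rays, both traversed in the direction of the orientation, add up to $0$. Let $p\in\{0,\infty\}$, and let $\xi$ be the coordinate of $\mathbb{P}^1$ centered at $p$: $\xi=\zeta$ if $p=0$ and $\xi=1/\zeta$ if $p=\infty$. A *solution* is a pair $X^+,X^-$, with $X^\pm$ analytic on $D^\pm$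 and continuous on $\overline{D^\pm}\setminus\{0\}$, such that $X^+(t)=G(t)X^-(t)$ for all $t\in\ell\setminus\{0\}$ and such that, for some $C$ and some $0\le\eta<1$, $|X^\pm|<C/|\xi|^\eta$ on $\overline{D^\pm}\setminus\{0\}$. Then there is a solution $X^\pm$ that vanishes nowhere on $\overline{D^\pm}\setminus\{0\}$, and every solution is of the form $(cX^+,cX^-)$ with a constant $c\in\mathbb{C}$. Moreover there are exponents $\eta_0,\eta_\infty\in\mathbb{C}$ with $$e^{2\pi i\eta_0}=\frac{G(0-0)}{G(0+0)},\qquad e^{2\pi i\eta_\infty}=\frac{G(\infty-0)}{G(\infty+0)},\qquad \operatorname{Re}\eta_\infty=-\operatorname{Re}\eta_0,$$ where $-1<\operatorname{Re}\eta_0\le0$ if $p=0$ and $0\le\operatorname{Re}\eta_0<1$ if $p=\infty$, such that (for any continuous branches of the powers on $\overline{D^\pm}\setminus\{0\}$) $X^\pm(\zeta)/\zeta^{\eta_0}$ has a finite nonzero limit as $\zeta\to0$ in $\overline{D^\pm}$, and $X^\pm(\zeta)/\zeta^{-\eta_\infty}$ has a finite nonzero limit as $\zeta\to\infty$ in $\overline{D^\pm}$.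 -/

import Mathlib

open Filter Topology

namespace JumpRH

/-- The closed half-plane to the left of the line `ℝ u` oriented by `u`, without the point `0`. -/
def leftClosed (u : ℂ) : Set ℂ := {z | z ≠ 0 ∧ 0 ≤ (z / u).im}

/-- The closed half-plane to the right of the oriented line, without the point `0`. -/
def rightClosed (u : ℂ) : Set ℂ := {z | z ≠ 0 ∧ (z / u).im ≤ 0}

/-- The open half-plane to the left of the oriented line. -/
def leftOpen (u : ℂ) : Set ℂ := {z | 0 < (z / u).im}

/-- The open half-plane to the right of the oriented line. -/
def rightOpen (u : ℂ) : Set ℂ := {z | (z / u).im < 0}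

/-- The chordal distance (up to the factor `2`) of two points with parameters `s`, `t` on a line
through `0` in the Riemann sphere. -/
noncomputable def chordal (s t : ℝ) : ℝ :=
  |s - t| / (Real.sqrt (1 + s ^ 2) * Real.sqrt (1 + t ^ 2))

/-- `G` is a nonvanishing coefficient on the line `ℝ u` that is Hölder continuous, except for
discontinuities of the first kind at `0` and `∞`: on each of the two closed arcs from `0` to `∞`
it is Hölder continuous for the metric of the Riemann sphere.  Following the orientation, a point
moves along the line through `0` (from `G(0-0)` to `G(0+0)`), on to `∞`, which it reaches with
parameters `t → +∞` (value `G(∞-0)`) and leaves with parameters `t → -∞` (value `G(∞+0)`). -/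
structure IsJumpCoefficient (u : ℂ) (G : ℂ → ℂ)
    (zeroPlus zeroMinus inftyPlus inftyMinus : ℂ) : Prop where
  holder : ∃ K μ : ℝ, 0 < μ ∧ μ ≤ 1 ∧ ∀ s t : ℝ, 0 < s * t →
    ‖G (s * u) - G (t * u)‖ ≤ K * chordal s t ^ μ
  ne_zero : ∀ t : ℝ, t ≠ 0 → G (t * u) ≠ 0
  tendsto_zeroPlus : Tendsto (fun t : ℝ => G (t * u)) (𝓝[>] 0) (𝓝 zeroPlus)
  tendsto_zeroMinus : Tendsto (fun t : ℝ => G (t * u)) (𝓝[<] 0) (𝓝 zeroMinus)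
  tendsto_inftyMinus : Tendsto (fun t : ℝ => G (t * u)) atTop (𝓝 inftyMinus)
  tendsto_inftyPlus : Tendsto (fun t : ℝ => G (t * u)) atBot (𝓝 inftyPlus)
  zeroPlus_ne : zeroPlus ≠ 0
  zeroMinus_ne : zeroMinus ≠ 0
  inftyPlus_ne : inftyPlus ≠ 0
  inftyMinus_ne : inftyMinus ≠ 0

/-- The winding of `G` along the line is zero: for an argument `φ` of `G` that is continuous on
each of the two rays, the changes of `φ` along the two rays (in the direction of the orientation)
add up to zero.  Adding a constant to `φ` on one of the rays does not change the sum. -/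
def HasZeroIndex (u : ℂ) (G : ℂ → ℂ) : Prop :=
  ∃ φ : ℝ → ℝ, ContinuousOn φ {0}ᶜ ∧
    (∀ t : ℝ, t ≠ 0 → G (t * u) = ‖G (t * u)‖ * Complex.exp (φ t * Complex.I)) ∧
    Tendsto (fun r : ℝ => (φ r⁻¹ - φ r) + (φ (-r) - φ (-r⁻¹))) (𝓝[>] 0) (𝓝 0)

/-- The point of the line at which an integrable singularity is admitted. -/
inductive SingularPoint
  | zero
  | infty

/-- The coordinate of the Riemann sphere centred at the given point. -/
noncomputable def SingularPoint.coord : SingularPoint → ℂ → ℂ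
  | .zero, z => z
  | .infty, z => z⁻¹

/-- The range of `Re η₀` for the branch that belongs to a singularity at the given point. -/
def SingularPoint.exponentRange : SingularPoint → Set ℝ
  | .zero => Set.Ioc (-1) 0
  | .infty => Set.Ico 0 1

/-- `Xp`, `Xm` solve the homogeneous problem `X⁺ = G X⁻` on the line `ℝ u`, with an integrable
singularity at `p` only. -/
structure IsSolution (u : ℂ) (G : ℂ → ℂ) (p : SingularPoint) (Xp Xm : ℂ → ℂ) : Prop where
  analytic_left : DifferentiableOn ℂ Xp (leftOpen u)
  analytic_right : DifferentiableOn ℂ Xm (rightOpen u)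
  continuous_left : ContinuousOn Xp (leftClosed u)
  continuous_right : ContinuousOn Xm (rightClosed u)
  boundary : ∀ t : ℝ, t ≠ 0 → Xp (t * u) = G (t * u) * Xm (t * u)
  growth : ∃ C η : ℝ, 0 ≤ η ∧ η < 1 ∧
    (∀ z ∈ leftClosed u, ‖Xp z‖ < C / ‖p.coord z‖ ^ η) ∧
    (∀ z ∈ rightClosed u, ‖Xm z‖ < C / ‖p.coord z‖ ^ η)

/-- The branch of `z ^ η` on the left closed half-plane that is `1` at `i u`. -/
noncomputable def powLeft (u η z : ℂ) : ℂ := (z / (Complex.I * u)) ^ η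

/-- The branch of `z ^ η` on the right closed half-plane that is `1` at `-i u`. -/
noncomputable def powRight (u η z : ℂ) : ℂ := (z / (-Complex.I * u)) ^ η

/-- `X⁺` and `X⁻` are `z ^ α` times functions with finite nonzero limits, along a filter `l`
(the approach to `0` or to `∞`). -/
def HasBranchFactor (u : ℂ) (l : Filter ℂ) (α : ℂ) (Xp Xm : ℂ → ℂ) : Prop :=
  (∃ L : ℂ, L ≠ 0 ∧ Tendsto (fun z => Xp z / powLeft u α z) (l ⊓ 𝓟 (leftClosed u)) (𝓝 L)) ∧
  (∃ L : ℂ, L ≠ 0 ∧ Tendsto (fun z => Xm z / powRight u α z) (l ⊓ 𝓟 (rightClosed u)) (𝓝 L))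

end JumpRH

namespace JumpRH

open Set MeasureTheory Metric

/-! The substitution t = tan(a/2) turns the compactified line into the unit circle, chordal Hölder
continuity into Hölder continuity in the angle a, and the two rays into the arcs [0, π] and [-π, 0].
On these, `exists_isLogPair` gives Hölder continuous logarithms F₁, F₂ of G. Their jumps at a = 0
and a = ±π, divided by 2πi, are the exponents η₀ and η_∞. Index zero says Re η_∞ = -Re η₀, and
adding a multiple of 2πi to F₂ brings Re η₀ into the prescribed interval.

Rotate each half-plane onto the right half-plane, with coordinate v, and put κ = -η_∞ - η₀, which is
purely imaginary. The model factor v^η₀ (1 + v)^κ has exponent η₀ at 0 and -η_∞ at ∞, so it absorbs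
both jumps: what remains of log G is continuous on the whole circle, hence Hölder
(`IsLogPair.exists_isHolderOn_remainder`, `IsHolderOn.comp_arg`). By Plemelj it splits as A(z) +
B(1/z) with A, B holomorphic in the disc and continuous up to the boundary
(`IsHolderOnCircle.exists_decomposition`). The solution is the model factor times exp A on the left
and times exp(-B) on the right, composed with the Cayley transform; `powerFactor_boundary` verifies
the jump relation.

For uniqueness, the quotient of any solution by this one extends continuously across the line, so it
is holomorphic off 0 by Morera. It is bounded by a power of |z| with exponent strictly between -1
and 1, which excludes both a pole at 0 and growth at ∞; by Liouville it is constant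
(`exists_eq_const_of_off_real`). -/

/-! ### Hölder functions on an interval and their logarithms. -/

/-- Hölder continuity of a function of a real variable on a set, with real constants. -/
def IsHolderOn (K μ : ℝ) (f : ℝ → ℂ) (S : Set ℝ) : Prop :=
  ∀ s ∈ S, ∀ t ∈ S, ‖f s - f t‖ ≤ K * |s - t| ^ μ

theorem IsHolderOn.uniformContinuousOn {K μ : ℝ} {f : ℝ → ℂ} {S : Set ℝ}
    (h : IsHolderOn K μ f S) (hμ : 0 < μ) : UniformContinuousOn f S := by
  rw [Metric.uniformContinuousOn_iff]
  intro ε hε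
  have hc : Tendsto (fun x : ℝ => K * |x| ^ μ) (𝓝 0) (𝓝 0) := by
    have : Tendsto (fun x : ℝ => K * |x| ^ μ) (𝓝 0) (𝓝 (K * |(0 : ℝ)| ^ μ)) :=
      Tendsto.const_mul _ ((continuous_abs.tendsto 0).rpow_const (Or.inr hμ.le))
    simpa [Real.zero_rpow hμ.ne'] using this
  obtain ⟨δ, hδ, hd⟩ := Metric.eventually_nhds_iff.1 (hc.eventually (gt_mem_nhds hε))
  refine ⟨δ, hδ, fun s hs t ht hst => ?_⟩
  rw [dist_eq_norm]
  refine (h s hs t ht).trans_lt (hd ?_)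
  simpa [Real.dist_eq] using hst

theorem UniformContinuousOn.exists_tendsto_nhdsWithin {f : ℝ → ℂ} {S : Set ℝ}
    (h : UniformContinuousOn f S) {a : ℝ} (ha : a ∈ closure S) :
    ∃ L, Tendsto f (𝓝[S] a) (𝓝 L) := by
  have : (𝓝[S] a).NeBot := mem_closure_iff_nhdsWithin_neBot.1 ha
  have hc : Cauchy (𝓝[S] a) := cauchy_nhds.mono inf_le_left
  exact cauchy_map_iff_exists_tendsto.1 (hc.map_of_le h inf_le_right)

theorem IsHolderOn.Icc_of_Ioo {K μ : ℝ} {f : ℝ → ℂ} {a b : ℝ} (hab : a < b)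
    (h : IsHolderOn K μ f (Ioo a b)) (hμ : 0 < μ) (hc : ContinuousOn f (Icc a b)) :
    IsHolderOn K μ f (Icc a b) := by
  intro s hs t ht
  have hcl : closure (Ioo a b ×ˢ Ioo a b) = Icc a b ×ˢ Icc a b := by
    rw [closure_prod_eq, closure_Ioo hab.ne]
  have hx : (s, t) ∈ closure (Ioo a b ×ˢ Ioo a b) := by rw [hcl]; exact ⟨hs, ht⟩
  refine ContinuousWithinAt.closure_le (f := fun x : ℝ × ℝ => ‖f x.1 - f x.2‖)
    (g := fun x : ℝ × ℝ => K * |x.1 - x.2| ^ μ) hx ?_ ?_ (fun y hy => h _ hy.1 _ hy.2)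
  · have h1 : ContinuousOn (fun x : ℝ × ℝ => ‖f x.1 - f x.2‖) (Icc a b ×ˢ Icc a b) :=
      ((hc.comp continuousOn_fst fun x hx => hx.1).sub
        (hc.comp continuousOn_snd fun x hx => hx.2)).norm
    exact (h1 (s, t) ⟨hs, ht⟩).mono (prod_mono Ioo_subset_Icc_self Ioo_subset_Icc_self)
  · have h2 : Continuous (fun x : ℝ × ℝ => K * |x.1 - x.2| ^ μ) :=
      continuous_const.mul ((continuous_fst.sub continuous_snd).abs.rpow_const
        fun _ => Or.inr hμ.le)
    exact h2.continuousAt.continuousWithinAt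

theorem IsHolderOn.exists_extension {K μ : ℝ} {f : ℝ → ℂ} {a b : ℝ} (hab : a < b)
    (h : IsHolderOn K μ f (Ioo a b)) (hμ : 0 < μ) :
    ∃ F : ℝ → ℂ, EqOn F f (Ioo a b) ∧ IsHolderOn K μ F (Icc a b) ∧ ContinuousOn F (Icc a b) := by
  have huc := h.uniformContinuousOn hμ
  obtain ⟨la, hla⟩ := UniformContinuousOn.exists_tendsto_nhdsWithin huc (a := a)
    (by rw [closure_Ioo hab.ne]; exact left_mem_Icc.2 hab.le)
  obtain ⟨lb, hlb⟩ := UniformContinuousOn.exists_tendsto_nhdsWithin huc (a := b)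
    (by rw [closure_Ioo hab.ne]; exact right_mem_Icc.2 hab.le)
  rw [nhdsWithin_Ioo_eq_nhdsGT hab] at hla
  rw [nhdsWithin_Ioo_eq_nhdsLT hab] at hlb
  have hcont := continuousOn_Icc_extendFrom_Ioo huc.continuousOn hla hlb
  have heq : EqOn (extendFrom (Ioo a b) f) f (Ioo a b) := fun x hx =>
    extendFrom_extends huc.continuousOn _ hx
  refine ⟨extendFrom (Ioo a b) f, heq, IsHolderOn.Icc_of_Ioo hab ?_ hμ hcont, hcont⟩
  intro s hs t ht
  rw [heq hs, heq ht]
  exact h s hs t ht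

/-- A continuous function with values in `2πiℤ` is constant on a preconnected set. -/
theorem eq_of_exp_eq_one {D : ℝ → ℂ} {S : Set ℝ} (hS : IsPreconnected S) (hD : ContinuousOn D S)
    (h : ∀ r ∈ S, Complex.exp (D r) = 1) {s t : ℝ} (hs : s ∈ S) (ht : t ∈ S) : D s = D t := by
  have h2 : (2 * Real.pi * Complex.I : ℂ) ≠ 0 := Complex.two_pi_I_ne_zero
  have hT : IsDiscrete (range ((↑) : ℤ → ℝ)) :=
    Int.isClosedEmbedding_coe_real.isEmbedding.isDiscrete_range
  have key := hS.constant_of_mapsTo hT (f := fun r => (D r / (2 * Real.pi * Complex.I)).re)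
    (Complex.continuous_re.comp_continuousOn (hD.div_const _)) (fun r hr => by
      obtain ⟨n, hn⟩ := Complex.exp_eq_one_iff.1 (h r hr)
      refine ⟨n, ?_⟩
      simp only [hn]
      rw [mul_div_cancel_right₀ _ h2]; simp) hs ht
  obtain ⟨n, hn⟩ := Complex.exp_eq_one_iff.1 (h s hs)
  obtain ⟨m, hm⟩ := Complex.exp_eq_one_iff.1 (h t ht)
  simp only [hn, hm] at key
  rw [mul_div_cancel_right₀ _ h2, mul_div_cancel_right₀ _ h2] at key
  have : (n : ℝ) = m := by simpa using key
  rw [hn, hm]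
  norm_cast at this
  rw [this]

/-- A continuous logarithm varies no more than the function itself, as long as the function stays
close to its initial value. -/
theorem norm_log_sub_le {f ψ : ℝ → ℂ} {s t : ℝ}
    (hψ : ContinuousOn ψ (uIcc s t)) (he : ∀ r ∈ uIcc s t, Complex.exp (ψ r) = f r)
    (hf : ∀ r ∈ uIcc s t, ‖f r / f s - 1‖ ≤ 1 / 2) :
    ‖ψ t - ψ s‖ ≤ 3 / 2 * ‖f t / f s - 1‖ := by
  -- The quotient stays in the disc of radius 1/2 about 1, where the principal logarithm is
  -- continuous and |log(1 + w)| ≤ (3/2)|w|. It can differ from ψ r - ψ s only by a constant, which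
  -- is 0 at s.
  have hq : ∀ r ∈ uIcc s t, f r / f s ∈ Complex.slitPlane := by
    intro r hr
    refine Complex.mem_slitPlane_of_norm_lt_one (z := f r / f s - 1)
      ((hf r hr).trans_lt (by norm_num)) |> fun h => by simpa using h
  have hs0 : f s ≠ 0 := by rw [← he s left_mem_uIcc]; exact Complex.exp_ne_zero _
  have hfc : ContinuousOn f (uIcc s t) := (Complex.continuous_exp.comp_continuousOn hψ).congr
    fun r hr => (he r hr).symm
  have hD : ContinuousOn (fun r => ψ r - ψ s - Complex.log (f r / f s)) (uIcc s t) :=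
    (hψ.sub continuousOn_const).sub ((hfc.div_const _).clog hq)
  have h1 := eq_of_exp_eq_one isPreconnected_uIcc hD (fun r hr => by
    have : f r / f s ≠ 0 := Complex.slitPlane_ne_zero (hq r hr)
    rw [Complex.exp_sub, Complex.exp_log this, Complex.exp_sub, he r hr, he s left_mem_uIcc]
    exact div_self this) left_mem_uIcc (right_mem_uIcc (a := s) (b := t))
  have h2 : ψ t - ψ s = Complex.log (1 + (f t / f s - 1)) := by
    simp only [sub_self, div_self hs0, Complex.log_one] at h1
    rw [add_sub_cancel]
    exact (sub_eq_zero.1 h1.symm)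
  rw [h2]
  exact Complex.norm_log_one_add_half_le_self (hf t right_mem_uIcc)

/-- A continuous logarithm of a Hölder continuous function that is bounded away from `0` on a
bounded interval is Hölder continuous. -/
theorem IsHolderOn.exists_log {K μ m : ℝ} {f ψ : ℝ → ℂ} {a b : ℝ}
    (h : IsHolderOn K μ f (Ioo a b)) (hK : 0 ≤ K) (hμ : 0 < μ) (hm : 0 < m)
    (hfm : ∀ r ∈ Ioo a b, m ≤ ‖f r‖) (hψ : ContinuousOn ψ (Ioo a b))
    (he : ∀ r ∈ Ioo a b, Complex.exp (ψ r) = f r) : ∃ K', 0 ≤ K' ∧ IsHolderOn K' μ ψ (Ioo a b) := by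
  have hc : Tendsto (fun x : ℝ => K * |x| ^ μ) (𝓝 0) (𝓝 0) := by
    have : Tendsto (fun x : ℝ => K * |x| ^ μ) (𝓝 0) (𝓝 (K * |(0 : ℝ)| ^ μ)) :=
      Tendsto.const_mul _ ((continuous_abs.tendsto 0).rpow_const (Or.inr hμ.le))
    simpa [Real.zero_rpow hμ.ne'] using this
  -- Within distance δ the relative variation of f is at most 1/2, as |f| ≥ m.
  obtain ⟨δ, hδ, hd⟩ := Metric.eventually_nhds_iff.1
    (hc.eventually (gt_mem_nhds (show 0 < m / 2 by linarith)))
  have hloc : ∀ s ∈ Ioo a b, ∀ t ∈ Ioo a b, |s - t| < δ →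
      ‖ψ s - ψ t‖ ≤ 3 / 2 * (K / m) * |s - t| ^ μ := by
    intro s hs t ht hst
    have hsub : uIcc s t ⊆ Ioo a b := ordConnected_Ioo.uIcc_subset hs ht
    have hfs : 0 < ‖f s‖ := hm.trans_le (hfm s hs)
    have hfs0 : f s ≠ 0 := norm_pos_iff.1 hfs
    have hdiv : ∀ r ∈ uIcc s t, ‖f r / f s - 1‖ ≤ (K * |r - s| ^ μ) / m := by
      intro r hr
      have e : f r / f s - 1 = (f r - f s) / f s := by field_simp
      rw [e, norm_div]
      have : 0 ≤ K * |r - s| ^ μ := by positivity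
      exact div_le_div₀ this (h r (hsub hr) s hs) hm (hfm s hs)
    have hr1 : ∀ r ∈ uIcc s t, ‖f r / f s - 1‖ ≤ 1 / 2 := by
      intro r hr
      refine (hdiv r hr).trans ?_
      rw [div_le_iff₀ hm]
      have hrs : |r - s| < δ := by
        have := abs_sub_left_of_mem_uIcc hr
        rw [abs_sub_comm] at hst
        linarith
      have := hd (y := r - s) (by simpa [Real.dist_eq] using hrs)
      linarith
    have h1 := norm_log_sub_le (hψ.mono hsub) (fun r hr => he r (hsub hr)) hr1
    rw [norm_sub_rev, abs_sub_comm s t]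
    refine h1.trans ?_
    have h2 := hdiv t right_mem_uIcc
    calc _ ≤ 3 / 2 * ((K * |t - s| ^ μ) / m) := by gcongr
      _ = _ := by ring
  -- Any two points of the interval are joined by n equal steps shorter than δ; the extra δ in the
  -- numerator forces n > 0. Summing the local estimate costs the factor n.
  obtain ⟨n, hn⟩ := exists_nat_gt ((|b - a| + δ) / δ)
  have hn0 : (0 : ℝ) < n := lt_of_le_of_lt (by positivity) hn
  rw [div_lt_iff₀ hδ] at hn
  refine ⟨n * (3 / 2 * (K / m)), by positivity, fun s hs t ht => ?_⟩
  let x : ℕ → ℝ := fun k => s + k / n * (t - s)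
  have hx : ∀ k ≤ n, x k ∈ Ioo a b := by
    intro k hk
    have hk' : (k : ℝ) / n ≤ 1 := (div_le_one hn0).2 (by exact_mod_cast hk)
    exact (convex_Ioo a b).add_smul_sub_mem hs ht ⟨by positivity, hk'⟩
  have hstep : ∀ k, |x k - x (k + 1)| = |s - t| / n := by
    intro k
    have : x k - x (k + 1) = (s - t) / n := by simp only [x]; push_cast; ring
    rw [this, abs_div, abs_of_pos hn0]
  have hlt : |s - t| / n < δ := by
    rw [div_lt_iff₀ hn0]
    have h1 : |s - t| ≤ |b - a| := by
      rw [abs_le]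
      have := le_abs_self (b - a)
      constructor <;> linarith [hs.1, hs.2, ht.1, ht.2]
    linarith
  have hsum := dist_le_range_sum_of_dist_le (f := fun k => ψ (x k)) n
    (d := fun _ => 3 / 2 * (K / m) * |s - t| ^ μ) (fun {k} hk => by
      rw [dist_eq_norm]
      refine (hloc _ (hx k hk.le) _ (hx (k + 1) hk) (by rw [hstep]; exact hlt)).trans ?_
      rw [hstep]
      have : |s - t| / n ≤ |s - t| := div_le_self (abs_nonneg _) (by
        have : 0 < n := by exact_mod_cast hn0
        exact_mod_cast this)
      gcongr)
  have e0 : x 0 = s := by simp [x]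
  have en : x n = t := by simp [x, hn0.ne']
  simp only [e0, en, dist_eq_norm, Finset.sum_const, Finset.card_range, nsmul_eq_mul] at hsum
  linarith

/-! ### Cauchy integrals on the circle and the Plemelj decomposition. -/

/-- Hölder continuity on the unit circle. -/
def IsHolderOnCircle (K μ : ℝ) (H : ℂ → ℂ) : Prop :=
  ∀ z w : ℂ, ‖z‖ = 1 → ‖w‖ = 1 → ‖H z - H w‖ ≤ K * ‖z - w‖ ^ μ

theorem IsHolderOnCircle.continuousOn {K μ : ℝ} {H : ℂ → ℂ} (h : IsHolderOnCircle K μ H)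
    (hμ : 0 < μ) : ContinuousOn H (sphere 0 1) := by
  intro z hz
  rw [mem_sphere_zero_iff_norm] at hz
  have hc : Tendsto (fun w : ℂ => K * ‖w - z‖ ^ μ) (𝓝[sphere 0 1] z) (𝓝 0) := by
    have h0 : Continuous (fun w : ℂ => K * ‖w - z‖ ^ μ) :=
      continuous_const.mul ((continuous_id.sub continuous_const).norm.rpow_const
        fun _ => Or.inr hμ.le)
    have := h0.tendsto z
    simp only [sub_self, norm_zero, Real.zero_rpow hμ.ne', mul_zero] at this
    exact this.mono_left inf_le_left
  rw [ContinuousWithinAt, tendsto_iff_norm_sub_tendsto_zero]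
  refine squeeze_zero' (Eventually.of_forall fun _ => norm_nonneg _) ?_ hc
  filter_upwards [self_mem_nhdsWithin] with w hw
  exact h w z (mem_sphere_zero_iff_norm.1 hw) hz

theorem IsHolderOnCircle.comp_inv {K μ : ℝ} {H : ℂ → ℂ} (h : IsHolderOnCircle K μ H) :
    IsHolderOnCircle K μ (fun z => H z⁻¹) := by
  intro z w hz hw
  have hz0 : z ≠ 0 := norm_pos_iff.1 (by rw [hz]; exact one_pos)
  have hw0 : w ≠ 0 := norm_pos_iff.1 (by rw [hw]; exact one_pos)
  have e : ‖z⁻¹ - w⁻¹‖ = ‖z - w‖ := by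
    rw [inv_sub_inv hz0 hw0, norm_div, norm_mul, hz, hw, norm_sub_rev]; simp
  rw [← e]
  exact h _ _ (by simp [hz]) (by simp [hw])

/-- The regularised Cauchy integral of `H` at the point `r ζ`, where `ζ` lies on the circle. -/
noncomputable def regularizedCauchy (H : ℂ → ℂ) (r : ℝ) (ζ : ℂ) : ℂ :=
  (2 * Real.pi : ℂ)⁻¹ * ∫ θ in (-Real.pi)..Real.pi,
    (H (ζ * Complex.exp (θ * Complex.I)) - H ζ) *
      (Complex.exp (θ * Complex.I) / (Complex.exp (θ * Complex.I) - r))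

theorem intervalIntegrable_abs_rpow {s : ℝ} (hs : -1 < s) (a : ℝ) (ha : 0 ≤ a) :
    IntervalIntegrable (fun θ : ℝ => |θ| ^ s) volume (-a) a := by
  have h1 : IntervalIntegrable (fun θ : ℝ => |θ| ^ s) volume 0 a := by
    refine (intervalIntegral.intervalIntegrable_rpow' (a := 0) (b := a) hs).congr ?_
    intro x hx
    rw [uIoc_of_le ha] at hx
    simp [abs_of_pos hx.1]
  have h2 : IntervalIntegrable (fun θ : ℝ => |θ| ^ s) volume (-a) 0 := by
    have := h1.comp_sub_left 0
    simp only [zero_sub, abs_neg, sub_self] at this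
    exact this.symm
  exact h2.trans h1

theorem two_div_pi_mul_abs_le_norm_exp_sub_one {θ : ℝ} (h : |θ| ≤ Real.pi) :
    2 / Real.pi * |θ| ≤ ‖Complex.exp (θ * Complex.I) - 1‖ := by
  rw [mul_comm (θ : ℂ), Complex.norm_exp_I_mul_ofReal_sub_one, norm_mul, Real.norm_eq_abs,
    Real.norm_eq_abs, abs_two]
  have h2 : |θ / 2| = |θ| / 2 := by rw [abs_div, abs_two]
  have := Real.mul_abs_le_abs_sin (x := θ / 2) (by rw [h2]; linarith)
  rw [h2] at this
  linarith

theorem norm_exp_sub_one_le_abs (θ : ℝ) : ‖Complex.exp (θ * Complex.I) - 1‖ ≤ |θ| := by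
  rw [mul_comm]
  exact Real.norm_exp_I_mul_ofReal_sub_one_le

/-- The distance from r to 1 is | |r| - |w| |, which is at most |w - r|. This bounds the Cauchy
kernel uniformly in r, including r = 1. -/
theorem norm_sub_one_le_two_mul {w : ℂ} (hw : ‖w‖ = 1) {r : ℝ} (hr : 0 ≤ r) :
    ‖w - 1‖ ≤ 2 * ‖w - r‖ := by
  have h1 : ‖w - 1‖ ≤ ‖w - r‖ + ‖(r : ℂ) - 1‖ := by
    simpa using norm_sub_le_norm_sub_add_norm_sub w r 1
  have h2 : ‖(r : ℂ) - 1‖ = |r - 1| := by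
    rw [← Complex.ofReal_one, ← Complex.ofReal_sub, Complex.norm_real, Real.norm_eq_abs]
  have h3 := abs_norm_sub_norm_le w (r : ℂ)
  rw [hw, Complex.norm_real, Real.norm_eq_abs, abs_of_nonneg hr, abs_sub_comm] at h3
  linarith

/-- The Hölder numerator contributes |θ|^μ and the denominator is at least |θ|/π, so one integrable
majorant serves all radii and all points of the circle. -/
theorem norm_regularizedCauchy_integrand_le {K μ : ℝ} {H : ℂ → ℂ} (h : IsHolderOnCircle K μ H)
    (hK : 0 ≤ K) (hμ : 0 < μ) {r : ℝ} (hr : 0 ≤ r) {ζ : ℂ} (hζ : ‖ζ‖ = 1) {θ : ℝ}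
    (hθ : |θ| ≤ Real.pi) :
    ‖(H (ζ * Complex.exp (θ * Complex.I)) - H ζ) *
      (Complex.exp (θ * Complex.I) / (Complex.exp (θ * Complex.I) - r))‖ ≤
      K * Real.pi * |θ| ^ (μ - 1) := by
  have he : ‖Complex.exp (θ * Complex.I)‖ = 1 := Complex.norm_exp_ofReal_mul_I θ
  rcases eq_or_ne θ 0 with rfl | h0
  · have := Real.pi_pos
    simp; positivity
  have h0' : 0 < |θ| := abs_pos.2 h0
  have hd : |θ| / Real.pi ≤ ‖Complex.exp (θ * Complex.I) - r‖ := by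
    have h1 := two_div_pi_mul_abs_le_norm_exp_sub_one hθ
    have h2 := norm_sub_one_le_two_mul he hr
    have : 2 / Real.pi * |θ| = 2 * (|θ| / Real.pi) := by ring
    linarith
  have hH : ‖H (ζ * Complex.exp (θ * Complex.I)) - H ζ‖ ≤ K * |θ| ^ μ := by
    refine (h _ _ (by rw [norm_mul, hζ, he, one_mul]) hζ).trans ?_
    have e : ζ * Complex.exp (θ * Complex.I) - ζ = ζ * (Complex.exp (θ * Complex.I) - 1) := by ring
    rw [e, norm_mul, hζ, one_mul]
    have := norm_exp_sub_one_le_abs θ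
    gcongr
  have hpi := Real.pi_pos
  rw [norm_mul, norm_div, he]
  calc _ ≤ (K * |θ| ^ μ) * (1 / (|θ| / Real.pi)) := by gcongr
    _ = _ := by rw [Real.rpow_sub_one h0'.ne']; field_simp

theorem aestronglyMeasurable_regularizedCauchy_integrand {H : ℂ → ℂ}
    (hH : ContinuousOn H (sphere 0 1)) (r : ℝ) {ζ : ℂ} (hζ : ‖ζ‖ = 1) (ν : Measure ℝ) :
    AEStronglyMeasurable (fun θ : ℝ => (H (ζ * Complex.exp (θ * Complex.I)) - H ζ) *
      (Complex.exp (θ * Complex.I) / (Complex.exp (θ * Complex.I) - r))) ν := by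
  have h1 : Continuous (fun θ : ℝ => H (ζ * Complex.exp (θ * Complex.I)) - H ζ) := by
    refine Continuous.sub ?_ continuous_const
    refine hH.comp_continuous (by fun_prop) fun θ => ?_
    rw [mem_sphere_zero_iff_norm, norm_mul, hζ, Complex.norm_exp_ofReal_mul_I, one_mul]
  refine h1.aestronglyMeasurable.mul ?_
  refine Measurable.aestronglyMeasurable ?_
  exact (by fun_prop : Measurable fun θ : ℝ => Complex.exp (θ * Complex.I)).div (by fun_prop)

theorem intervalIntegrable_regularizedCauchy_integrand {K μ : ℝ} {H : ℂ → ℂ}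
    (h : IsHolderOnCircle K μ H) (hK : 0 ≤ K) (hμ : 0 < μ) {r : ℝ} (hr : 0 ≤ r) {ζ : ℂ}
    (hζ : ‖ζ‖ = 1) :
    IntervalIntegrable (fun θ : ℝ => (H (ζ * Complex.exp (θ * Complex.I)) - H ζ) *
      (Complex.exp (θ * Complex.I) / (Complex.exp (θ * Complex.I) - r))) volume
      (-Real.pi) Real.pi := by
  have hpi := Real.pi_pos
  refine ((intervalIntegrable_abs_rpow (by linarith : -1 < μ - 1) Real.pi hpi.le).const_mul
    (K * Real.pi)).mono_fun'
    (aestronglyMeasurable_regularizedCauchy_integrand (h.continuousOn hμ) r hζ _) ?_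
  refine (ae_restrict_iff' measurableSet_uIoc).2 (Eventually.of_forall fun θ hθ => ?_)
  rw [uIoc_of_le (by linarith)] at hθ
  exact norm_regularizedCauchy_integrand_le h hK hμ hr hζ (abs_le.2 ⟨hθ.1.le, hθ.2⟩)

/-- Dominated convergence: the kernel can be singular only at θ = 0, a null set. Continuity at r = 1
is what yields boundary values of the Cauchy integral. -/
theorem continuousOn_regularizedCauchy {K μ : ℝ} {H : ℂ → ℂ} (h : IsHolderOnCircle K μ H)
    (hK : 0 ≤ K) (hμ : 0 < μ) :
    ContinuousOn (fun x : ℝ × ℂ => regularizedCauchy H x.1 x.2) (Ici 0 ×ˢ sphere 0 1) := by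
  have hpi := Real.pi_pos
  have hH := h.continuousOn hμ
  refine ContinuousOn.mul continuousOn_const fun x₀ hx₀ => ?_
  refine intervalIntegral.continuousWithinAt_of_dominated_interval
    (bound := fun θ => K * Real.pi * |θ| ^ (μ - 1)) ?_ ?_
    ((intervalIntegrable_abs_rpow (by linarith : -1 < μ - 1) Real.pi hpi.le).const_mul
    (K * Real.pi)) ?_
  · filter_upwards [self_mem_nhdsWithin] with x hx
    exact aestronglyMeasurable_regularizedCauchy_integrand hH x.1
      (mem_sphere_zero_iff_norm.1 hx.2) _
  · filter_upwards [self_mem_nhdsWithin] with x hx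
    refine Eventually.of_forall fun θ hθ => ?_
    rw [uIoc_of_le (by linarith)] at hθ
    exact norm_regularizedCauchy_integrand_le h hK hμ hx.1 (mem_sphere_zero_iff_norm.1 hx.2)
      (abs_le.2 ⟨hθ.1.le, hθ.2⟩)
  · have hne : ∀ᵐ θ : ℝ, θ ≠ 0 := by simp [ae_iff, measure_singleton]
    filter_upwards [hne] with θ h0 hθ
    rw [uIoc_of_le (by linarith)] at hθ
    have hden : Complex.exp (θ * Complex.I) - (x₀.1 : ℂ) ≠ 0 := by
      have h1 := two_div_pi_mul_abs_le_norm_exp_sub_one (abs_le.2 ⟨hθ.1.le, hθ.2⟩)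
      have h2 := norm_sub_one_le_two_mul (Complex.norm_exp_ofReal_mul_I θ) hx₀.1
      have : 0 < 2 / Real.pi * |θ| := by positivity
      exact norm_pos_iff.1 (by linarith)
    refine ContinuousWithinAt.mul (ContinuousWithinAt.sub ?_ ?_) ?_
    · have hc : ContinuousOn (fun x : ℝ × ℂ => H (x.2 * Complex.exp (θ * Complex.I)))
          (Ici 0 ×ˢ sphere 0 1) := hH.comp (by fun_prop) fun x hx => by
        rw [mem_sphere_zero_iff_norm, norm_mul, mem_sphere_zero_iff_norm.1 hx.2,
          Complex.norm_exp_ofReal_mul_I, one_mul]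
      exact hc x₀ hx₀
    · have hc : ContinuousOn (fun x : ℝ × ℂ => H x.2) (Ici 0 ×ˢ sphere 0 1) :=
        hH.comp continuousOn_snd fun x hx => hx.2
      exact hc x₀ hx₀
    · exact ContinuousWithinAt.div (by fun_prop) (by fun_prop) hden

/-- The Cauchy integral of `H`, extended to the closed disc. -/
noncomputable def cauchyExtension (H : ℂ → ℂ) (z : ℂ) : ℂ :=
  H (Complex.exp (z.arg * Complex.I)) +
    regularizedCauchy H ‖z‖ (Complex.exp (z.arg * Complex.I))

/-- Rotating the circle by arg z puts z on the positive axis, so that the kernel depends only on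
‖z‖. -/
theorem circleIntegral_eq_integral (F : ℂ → ℂ) (z : ℂ) :
    (∮ w in C(0, 1), (w - z)⁻¹ • F w) = Complex.I * ∫ θ in (-Real.pi)..Real.pi,
      F (Complex.exp (z.arg * Complex.I) * Complex.exp (θ * Complex.I)) *
        (Complex.exp (θ * Complex.I) / (Complex.exp (θ * Complex.I) - ‖z‖)) := by
  set f : ℝ → ℂ := fun θ => deriv (circleMap 0 1) θ • (fun w => (w - z)⁻¹ • F w) (circleMap 0 1 θ)
    with hf
  have hper : Function.Periodic f (2 * Real.pi) := fun θ => by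
    simp only [hf, deriv_circleMap, periodic_circleMap _ _ θ]
  have h1 : (∮ w in C(0, 1), (w - z)⁻¹ • F w) = ∫ θ in (-Real.pi)..Real.pi, f (z.arg + θ) := by
    have h2 := hper.intervalIntegral_add_eq 0 (z.arg + -Real.pi)
    rw [zero_add] at h2
    rw [circleIntegral, h2, intervalIntegral.integral_comp_add_left]
    congr 1; ring
  rw [h1, ← intervalIntegral.integral_const_mul]
  congr 1 with θ
  have hz : z = ‖z‖ * Complex.exp (z.arg * Complex.I) := (Complex.norm_mul_exp_arg_mul_I z).symm
  simp only [hf, deriv_circleMap, circleMap_zero, Complex.ofReal_one, one_mul, smul_eq_mul,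
    Complex.ofReal_add, add_mul, Complex.exp_add]
  set e := Complex.exp (z.arg * Complex.I) with he
  set x := Complex.exp (θ * Complex.I)
  have he0 : e ≠ 0 := Complex.exp_ne_zero _
  have hz' : e * x - z = e * (x - ‖z‖) := by
    conv_lhs => rw [hz]
    ring
  rw [hz', mul_inv]
  field_simp

/-- The subtracted term H(e) is multiplied by the Cauchy integral of the constant 1, so it cancels
the term added in `cauchyExtension`. -/
theorem cauchyExtension_eq_circleIntegral {H : ℂ → ℂ} (hH : ContinuousOn H (sphere 0 1))
    {z : ℂ} (hz : ‖z‖ < 1) :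
    cauchyExtension H z = (2 * Real.pi * Complex.I : ℂ)⁻¹ • ∮ w in C(0, 1), (w - z)⁻¹ • H w := by
  have h1 := circleIntegral_eq_integral (fun _ => 1) z
  have h2 := circleIntegral_eq_integral H z
  have h3 : (∮ w in C(0, 1), (w - z)⁻¹ • (1 : ℂ)) = 2 * Real.pi * Complex.I := by
    simpa using circleIntegral.integral_sub_inv_of_mem_ball (c := 0) (w := z) (R := 1)
      (by simpa using hz)
  rw [h3] at h1
  rw [h2, cauchyExtension, regularizedCauchy]
  set e := Complex.exp (z.arg * Complex.I)
  have hne : ∀ θ : ℝ, Complex.exp (θ * Complex.I) - (‖z‖ : ℂ) ≠ 0 := by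
    intro θ h
    have := congrArg norm (sub_eq_zero.1 h)
    rw [Complex.norm_exp_ofReal_mul_I, Complex.norm_real, norm_norm] at this
    linarith
  have hk : Continuous fun θ : ℝ =>
      Complex.exp (θ * Complex.I) / (Complex.exp (θ * Complex.I) - ‖z‖) :=
    Continuous.div (by fun_prop) (by fun_prop) hne
  have hHc : Continuous fun θ : ℝ => H (e * Complex.exp (θ * Complex.I)) :=
    hH.comp_continuous (by fun_prop) fun θ => by
      rw [mem_sphere_zero_iff_norm, norm_mul, Complex.norm_exp_ofReal_mul_I,
        Complex.norm_exp_ofReal_mul_I, one_mul]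
  simp only [sub_mul]
  have hi1 : IntervalIntegrable (fun θ : ℝ => H (e * Complex.exp (θ * Complex.I)) *
      (Complex.exp (θ * Complex.I) / (Complex.exp (θ * Complex.I) - ‖z‖))) volume
      (-Real.pi) Real.pi := (hHc.mul hk).intervalIntegrable _ _
  have hi2 : IntervalIntegrable (fun θ : ℝ => H e *
      (Complex.exp (θ * Complex.I) / (Complex.exp (θ * Complex.I) - ‖z‖))) volume
      (-Real.pi) Real.pi := (continuous_const.mul hk).intervalIntegrable _ _
  rw [intervalIntegral.integral_sub hi1 hi2, intervalIntegral.integral_const_mul]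
  have h4 : (∫ θ in (-Real.pi)..Real.pi, (Complex.exp (θ * Complex.I) /
      (Complex.exp (θ * Complex.I) - ‖z‖))) = 2 * Real.pi := by
    simp only [one_mul] at h1
    have := mul_left_cancel₀ Complex.I_ne_zero (h1.symm.trans (mul_comm _ _))
    exact this
  rw [h4]
  have hpi : (Real.pi : ℂ) ≠ 0 := Complex.ofReal_ne_zero.2 Real.pi_ne_zero
  simp only [smul_eq_mul]
  generalize (∫ θ in (-Real.pi)..Real.pi, H (e * Complex.exp (θ * Complex.I)) *
      (Complex.exp (θ * Complex.I) / (Complex.exp (θ * Complex.I) - ‖z‖))) = J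
  field_simp
  ring

theorem differentiableOn_cauchyExtension {H : ℂ → ℂ} (hH : ContinuousOn H (sphere 0 1)) :
    DifferentiableOn ℂ (cauchyExtension H) (ball 0 1) := by
  have h1 : CircleIntegrable H 0 (1 : NNReal) := ContinuousOn.circleIntegrable (by simp) (by simpa)
  have h2 := (hasFPowerSeriesOn_cauchy_integral h1 one_pos).differentiableOn
  simp only [NNReal.coe_one, ENNReal.coe_one] at h2
  have : (eball (0 : ℂ) 1) = ball 0 1 := by
    rw [← ENNReal.ofReal_one, eball_ofReal]
  rw [this] at h2
  exact h2.congr fun z hz => cauchyExtension_eq_circleIntegral hH (by simpa using hz)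

/-- Away from 0 the argument enters only through exp(i arg z) = z/‖z‖, so its jump on the negative
axis does no harm; near 0 the function is holomorphic. -/
theorem continuousOn_cauchyExtension {K μ : ℝ} {H : ℂ → ℂ} (h : IsHolderOnCircle K μ H)
    (hK : 0 ≤ K) (hμ : 0 < μ) : ContinuousOn (cauchyExtension H) (closedBall 0 1) := by
  intro z hz
  rcases eq_or_ne z 0 with rfl | hz0
  · exact ((differentiableOn_cauchyExtension (h.continuousOn hμ)).continuousOn.continuousAt
      (ball_mem_nhds 0 one_pos)).continuousWithinAt
  have he : ∀ z : ℂ, z ≠ 0 → Complex.exp (z.arg * Complex.I) = z / ‖z‖ := by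
    intro z hz
    have : (‖z‖ : ℂ) ≠ 0 := by simpa using hz
    rw [eq_div_iff this, mul_comm, Complex.norm_mul_exp_arg_mul_I]
  have hn : ∀ z : ℂ, z ≠ 0 → z / ‖z‖ ∈ sphere (0 : ℂ) 1 := by
    intro z hz
    rw [← he z hz, mem_sphere_zero_iff_norm, Complex.norm_exp_ofReal_mul_I]
  have hd : ContinuousOn (fun z : ℂ => z / (‖z‖ : ℂ)) {0}ᶜ :=
    continuousOn_id.div (Complex.continuous_ofReal.comp continuous_norm).continuousOn
      fun z hz => by simpa using hz
  have hc : ContinuousOn (fun z : ℂ => H (z / ‖z‖) + regularizedCauchy H ‖z‖ (z / ‖z‖)) {0}ᶜ := by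
    refine ContinuousOn.add ((h.continuousOn hμ).comp hd fun z hz => hn z hz) ?_
    have hp : ContinuousOn (fun z : ℂ => (‖z‖, z / (‖z‖ : ℂ))) {0}ᶜ :=
      continuous_norm.continuousOn.prodMk hd
    have hm : MapsTo (fun z : ℂ => (‖z‖, z / (‖z‖ : ℂ))) {0}ᶜ (Ici (0 : ℝ) ×ˢ sphere (0 : ℂ) 1) :=
      fun z hz => mk_mem_prod (norm_nonneg z) (hn z hz)
    have h3 := (continuousOn_regularizedCauchy h hK hμ).comp hp hm
    simpa only [Function.comp_def] using h3
  have hc' : ContinuousOn (cauchyExtension H) {0}ᶜ :=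
    hc.congr fun z hz => by rw [cauchyExtension, he z hz]
  exact (hc'.continuousAt (isOpen_compl_singleton.mem_nhds hz0)).continuousWithinAt

/-- A Hölder continuous function on the unit circle is a sum of boundary values of functions
holomorphic inside and outside the disc. -/
theorem IsHolderOnCircle.exists_decomposition {K μ : ℝ} {H : ℂ → ℂ} (h : IsHolderOnCircle K μ H)
    (hK : 0 ≤ K) (hμ : 0 < μ) :
    ∃ A B : ℂ → ℂ, ContinuousOn A (closedBall 0 1) ∧ DifferentiableOn ℂ A (ball 0 1) ∧
      ContinuousOn B (closedBall 0 1) ∧ DifferentiableOn ℂ B (ball 0 1) ∧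
      ∀ z : ℂ, ‖z‖ = 1 → A z + B z⁻¹ = H z := by
  -- The Cauchy extensions of H and of H(1/·) both contain the mean of H; their sum on the circle is
  -- H + M, so M is subtracted from one of them.
  set M : ℂ := (2 * Real.pi : ℂ)⁻¹ * ∫ θ in (-Real.pi)..Real.pi, H (Complex.exp (θ * Complex.I))
    with hM
  have h' := h.comp_inv
  have hHc := h.continuousOn hμ
  refine ⟨cauchyExtension H, fun z => cauchyExtension (fun z => H z⁻¹) z - M,
    continuousOn_cauchyExtension h hK hμ, differentiableOn_cauchyExtension hHc,
    (continuousOn_cauchyExtension h' hK hμ).sub continuousOn_const,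
    (differentiableOn_cauchyExtension (h'.continuousOn hμ)).sub_const _, fun z hz => ?_⟩
  have hpi : (Real.pi : ℂ) ≠ 0 := Complex.ofReal_ne_zero.2 Real.pi_ne_zero
  have he : ∀ w : ℂ, ‖w‖ = 1 → Complex.exp (w.arg * Complex.I) = w := by
    intro w hw
    have := Complex.norm_mul_exp_arg_mul_I w
    rwa [hw, Complex.ofReal_one, one_mul] at this
  have hz' : ‖z⁻¹‖ = 1 := by simp [hz]
  simp only [cauchyExtension, he z hz, he _ hz', inv_inv, hz, hz']
  -- The reflection θ ↦ -θ replaces the kernel k = x/(x - 1) by 1 - k, so the singular parts of the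
  -- two extensions cancel.
  have hneg : regularizedCauchy (fun z => H z⁻¹) 1 z⁻¹ = (2 * Real.pi : ℂ)⁻¹ *
      ∫ θ in (-Real.pi)..Real.pi, (H (z * Complex.exp (θ * Complex.I)) - H z) *
      (1 - (Complex.exp (θ * Complex.I) / (Complex.exp (θ * Complex.I) - (1 : ℝ)))) := by
    rw [regularizedCauchy]
    congr 1
    rw [← neg_neg Real.pi, ← intervalIntegral.integral_comp_neg, neg_neg]
    refine intervalIntegral.integral_congr_ae ?_
    have hne : ∀ᵐ θ : ℝ, θ ≠ 0 := by simp [ae_iff, measure_singleton]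
    filter_upwards [hne] with θ h0 hθ
    rw [uIoc_of_le (by linarith [Real.pi_pos])] at hθ
    have hx : Complex.exp (θ * Complex.I) - 1 ≠ 0 := by
      have h1 := two_div_pi_mul_abs_le_norm_exp_sub_one (abs_le.2 ⟨hθ.1.le, hθ.2⟩)
      have : 0 < 2 / Real.pi * |θ| := by have := Real.pi_pos; positivity
      exact norm_pos_iff.1 (by linarith)
    have hx0 := Complex.exp_ne_zero (θ * Complex.I)
    rw [Complex.ofReal_neg, neg_mul, Complex.exp_neg, mul_inv, inv_inv, inv_inv,
      Complex.ofReal_one]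
    set x := Complex.exp (θ * Complex.I)
    have hx' : x⁻¹ - 1 ≠ 0 := by
      intro h
      apply hx
      field_simp at h
      linear_combination -h
    congr 1
    have : 1 - x ≠ 0 := fun h => hx (by linear_combination -h)
    field_simp
    ring
  have hmean : (∫ θ in (-Real.pi)..Real.pi, H (z * Complex.exp (θ * Complex.I))) =
      ∫ θ in (-Real.pi)..Real.pi, H (Complex.exp (θ * Complex.I)) := by
    have hper : Function.Periodic (fun θ : ℝ => H (Complex.exp (θ * Complex.I)))
        (2 * Real.pi) := fun θ => by
      have := Complex.exp_periodic (θ * Complex.I)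
      simp only [Complex.ofReal_add, Complex.ofReal_mul, Complex.ofReal_ofNat, add_mul]
      rw [this]
    have h2 := hper.intervalIntegral_add_eq (-Real.pi) (z.arg + -Real.pi)
    have e1 : -Real.pi + 2 * Real.pi = Real.pi := by ring
    have e2 : z.arg + -Real.pi + 2 * Real.pi = z.arg + Real.pi := by ring
    rw [e1, e2] at h2
    rw [h2, ← intervalIntegral.integral_comp_add_left]
    congr 1 with θ
    rw [Complex.ofReal_add, add_mul, Complex.exp_add, he z hz]
  have hHz : Continuous fun θ : ℝ => H (z * Complex.exp (θ * Complex.I)) :=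
    hHc.comp_continuous (by fun_prop) fun θ => by
      rw [mem_sphere_zero_iff_norm, norm_mul, hz, Complex.norm_exp_ofReal_mul_I, one_mul]
  have hi := intervalIntegrable_regularizedCauchy_integrand h hK hμ zero_le_one hz
  have hsum : (∫ θ in (-Real.pi)..Real.pi, (H (z * Complex.exp (θ * Complex.I)) - H z) *
      (1 - (Complex.exp (θ * Complex.I) / (Complex.exp (θ * Complex.I) - (1 : ℝ))))) =
      2 * Real.pi * M - 2 * Real.pi * H z -
        ∫ θ in (-Real.pi)..Real.pi, (H (z * Complex.exp (θ * Complex.I)) - H z) *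
      (Complex.exp (θ * Complex.I) / (Complex.exp (θ * Complex.I) - (1 : ℝ))) := by
    simp only [mul_sub, mul_one]
    simp only [← mul_sub]
    have hi1 : IntervalIntegrable (fun θ : ℝ => H (z * Complex.exp (θ * Complex.I)) - H z) volume
      (-Real.pi) Real.pi := (hHz.sub continuous_const).intervalIntegrable _ _
    rw [intervalIntegral.integral_sub hi1 hi, intervalIntegral.integral_sub (hHz.intervalIntegrable _ _)
        (continuous_const.intervalIntegrable _ _), hmean, hM,
      intervalIntegral.integral_const, Complex.real_smul]
    generalize (∫ θ in (-Real.pi)..Real.pi, (H (z * Complex.exp (θ * Complex.I)) - H z) *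
      (Complex.exp (θ * Complex.I) / (Complex.exp (θ * Complex.I) - (1 : ℝ)))) = J
    generalize (∫ θ in (-Real.pi)..Real.pi, H (Complex.exp (θ * Complex.I))) = J'
    push_cast
    field_simp
    ring
  rw [hneg, hsum, regularizedCauchy]
  generalize (∫ θ in (-Real.pi)..Real.pi, (H (z * Complex.exp (θ * Complex.I)) - H z) *
      (Complex.exp (θ * Complex.I) / (Complex.exp (θ * Complex.I) - (1 : ℝ)))) = J
  field_simp
  ring

/-! ### Morera across the real axis and Liouville. -/

/-- A rectangle meeting the real axis is cut along it. Each piece lies in a closed half-plane, where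
Cauchy's theorem needs only continuity on the boundary, and the integrals over the cut cancel. -/
theorem isConservativeOn_of_differentiableOn_off_real {f : ℂ → ℂ} {U : Set ℂ}
    (hc : ContinuousOn f U) (hp : DifferentiableOn ℂ f {z | 0 < z.im})
    (hm : DifferentiableOn ℂ f {z | z.im < 0}) : Complex.IsConservativeOn f U := by
  intro z w hzw
  rw [← add_eq_zero_iff_eq_neg, Complex.wedgeIntegral_add_wedgeIntegral_eq]
  have hzw' : uIcc z.re w.re ×ℂ uIcc z.im w.im ⊆ U := hzw
  have hrect : ∀ a b : ℂ, uIcc a.re b.re ×ℂ uIcc a.im b.im ⊆ U → (a.im = 0 ∨ b.im = 0 ∨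
      0 ∉ uIcc a.im b.im) →
      (∫ x : ℝ in a.re..b.re, f (x + a.im * Complex.I)) -
      (∫ x : ℝ in a.re..b.re, f (x + b.im * Complex.I)) +
      Complex.I • (∫ y : ℝ in a.im..b.im, f (b.re + y * Complex.I)) -
      Complex.I • (∫ y : ℝ in a.im..b.im, f (a.re + y * Complex.I)) = 0 := by
    intro a b hab h0
    refine Complex.integral_boundary_rect_eq_zero_of_continuousOn_of_differentiableOn f a b
      (hc.mono hab) ?_
    have hcase : 0 ≤ min a.im b.im ∨ max a.im b.im ≤ 0 := by
      rcases h0 with h | h | h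
      · rw [h]
        rcases le_total 0 b.im with h' | h' <;> simp [h']
      · rw [h]
        rcases le_total 0 a.im with h' | h' <;> simp [h']
      · rw [uIcc, mem_Icc, not_and_or, not_le, not_le] at h
        exact h.imp le_of_lt le_of_lt
    rcases hcase with h | h
    · exact hp.mono fun x hx => lt_of_le_of_lt h hx.2.1
    · exact hm.mono fun x hx => lt_of_lt_of_le hx.2.2 h
  by_cases h0 : (0 : ℝ) ∈ uIcc z.im w.im
  · have hs1 : uIcc z.im 0 ⊆ uIcc z.im w.im := uIcc_subset_uIcc_left h0
    have hs2 : uIcc 0 w.im ⊆ uIcc z.im w.im := uIcc_subset_uIcc_right h0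
    have h1 := hrect z ⟨w.re, 0⟩ (fun x hx => hzw' ⟨hx.1, hs1 hx.2⟩)
      (Or.inr (Or.inl rfl))
    have h2 := hrect ⟨z.re, 0⟩ w (fun x hx => hzw' ⟨hx.1, hs2 hx.2⟩)
      (Or.inl rfl)
    have hint : ∀ r ∈ uIcc z.re w.re, ∀ a b : ℝ, uIcc a b ⊆ uIcc z.im w.im →
        IntervalIntegrable (fun y : ℝ => f (r + y * Complex.I)) volume a b := by
      intro r hr a b hab
      refine (hc.comp (by fun_prop) fun y hy => hzw' ?_).intervalIntegrable
      simpa [Complex.mem_reProdIm] using ⟨hr, hab hy⟩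
    rw [← intervalIntegral.integral_add_adjacent_intervals
        (hint w.re right_mem_uIcc _ _ hs1) (hint w.re right_mem_uIcc _ _ hs2),
      ← intervalIntegral.integral_add_adjacent_intervals
        (hint z.re left_mem_uIcc _ _ hs1) (hint z.re left_mem_uIcc _ _ hs2)]
    simp only [smul_eq_mul] at h1 h2 ⊢
    linear_combination h1 + h2
  · exact hrect z w hzw' (Or.inr (Or.inr h0))

/-- A function that is continuous off `0`, holomorphic off the real axis and bounded by a power
of `‖z‖` with exponent in `(-1, 1)` is constant. -/
theorem exists_eq_const_of_off_real {f : ℂ → ℂ} (hc : ContinuousOn f {0}ᶜ)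
    (hp : DifferentiableOn ℂ f {z | 0 < z.im}) (hm : DifferentiableOn ℂ f {z | z.im < 0})
    {C e : ℝ} (he : -1 < e) (he' : e < 1) (hb : ∀ z ≠ 0, ‖f z‖ ≤ C * ‖z‖ ^ e) :
    ∃ c, ∀ z ≠ 0, f z = c := by
  have hd : DifferentiableOn ℂ f {0}ᶜ :=
    (Complex.isConservativeOn_and_continuousOn_iff_isDifferentiableOn isOpen_compl_singleton).1
      ⟨isConservativeOn_of_differentiableOn_off_real hc hp hm, hc⟩
  -- Since e > -1, z f(z) tends to 0 at 0, so its singularity there is removable; dividing by z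
  -- again extends f holomorphically.
  have hbound : ∀ z : ℂ, ‖z * f z‖ ≤ C * ‖z‖ ^ (e + 1) := by
    intro z
    rcases eq_or_ne z 0 with rfl | hz
    · simp [Real.zero_rpow (by linarith : e + 1 ≠ 0)]
    · rw [Real.rpow_add_one (norm_ne_zero_iff.2 hz), norm_mul]
      nlinarith [hb z hz, norm_nonneg z]
  have hcont0 : ContinuousAt (fun z => z * f z) 0 := by
    rw [ContinuousAt, zero_mul, tendsto_zero_iff_norm_tendsto_zero]
    refine squeeze_zero (fun _ => norm_nonneg _) hbound ?_
    have h1 : Continuous fun z : ℂ => C * ‖z‖ ^ (e + 1) :=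
      continuous_const.mul (continuous_norm.rpow_const fun _ => Or.inr (by linarith))
    simpa [Real.zero_rpow (by linarith : e + 1 ≠ 0)] using h1.tendsto 0
  have hR : DifferentiableOn ℂ (fun z => z * f z) univ := by
    rw [← Complex.differentiableOn_compl_singleton_and_continuousAt_iff (c := 0) univ_mem]
    refine ⟨?_, hcont0⟩
    rw [← compl_eq_univ_sdiff]
    exact differentiableOn_id.mul hd
  have hS : DifferentiableOn ℂ (dslope (fun z => z * f z) 0) univ :=
    (Complex.differentiableOn_dslope univ_mem).2 hR
  -- This entire function is (f(z) - s)/z off 0, with s the extended value at 0. It tends to 0 at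
  -- infinity because e < 1, hence vanishes.
  have hT : Differentiable ℂ (dslope (dslope (fun z => z * f z) 0) 0) :=
    differentiableOn_univ.1 ((Complex.differentiableOn_dslope univ_mem).2 hS)
  have hSf : ∀ z ≠ 0, dslope (fun z => z * f z) 0 z = f z := by
    intro z hz
    rw [dslope_of_ne _ hz, slope_def_field]
    field_simp
    simp [mul_comm]
  set s := dslope (fun z => z * f z) 0 0 with hs
  have hlim : Tendsto (dslope (dslope (fun z => z * f z) 0) 0) (cocompact ℂ) (𝓝 0) := by
    have hn : Tendsto (fun z : ℂ => ‖z‖) (cocompact ℂ) atTop := tendsto_norm_cocompact_atTop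
    have h1 : Tendsto (fun z : ℂ => C * ‖z‖ ^ (-(1 - e)) + ‖s‖ * ‖z‖⁻¹) (cocompact ℂ) (𝓝 0) := by
      have a1 := ((tendsto_rpow_neg_atTop (by linarith : 0 < 1 - e)).comp hn).const_mul C
      have a2 := (tendsto_inv_atTop_zero.comp hn).const_mul ‖s‖
      simpa using a1.add a2
    refine squeeze_zero_norm' ?_ h1
    have hne : ∀ᶠ z in cocompact ℂ, z ≠ (0 : ℂ) :=
      (hn.eventually (eventually_gt_atTop 0)).mono fun z hz => norm_pos_iff.1 hz
    filter_upwards [hne] with z hz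
    have hz' : 0 < ‖z‖ := norm_pos_iff.2 hz
    rw [dslope_of_ne _ hz, slope_def_field, hSf z hz, ← hs, sub_zero, norm_div,
      neg_sub, Real.rpow_sub_one hz'.ne', div_eq_mul_inv]
    have := hb z hz
    calc _ ≤ (C * ‖z‖ ^ e + ‖s‖) * ‖z‖⁻¹ := by
          gcongr
          exact (norm_sub_le _ _).trans (by linarith)
      _ = _ := by ring
  refine ⟨s, fun z hz => ?_⟩
  have h0 := hT.apply_eq_of_tendsto_cocompact z hlim
  rw [dslope_of_ne _ hz, slope_def_field, hSf z hz, sub_zero, div_eq_zero_iff] at h0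
  exact sub_eq_zero.1 (h0.resolve_right hz)

/-! ### The factors on the right half-plane and their behaviour at 0 and infinity. -/

/-- The closed right half-plane without `0`. -/
def rightHalf : Set ℂ := {v | v ≠ 0 ∧ 0 ≤ v.re}

/-- The product of the power `v ^ η`, of a power of `1 + v` and of the exponential of a function
on the disc, pulled back to the right half-plane. -/
noncomputable def powerFactor (η κ : ℂ) (E : ℂ → ℂ) (v : ℂ) : ℂ :=
  v ^ η * (1 + v) ^ κ * Complex.exp (E ((1 - v) / (1 + v)))

theorem mem_slitPlane_of_mem_rightHalf {v : ℂ} (hv : v ∈ rightHalf) : v ∈ Complex.slitPlane := by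
  rw [Complex.mem_slitPlane_iff]
  by_contra! h
  exact hv.1 (Complex.ext (le_antisymm h.1 hv.2) h.2)

theorem one_add_mem_slitPlane {v : ℂ} (hv : 0 ≤ v.re) : 1 + v ∈ Complex.slitPlane :=
  Or.inl (by simp; linarith)

theorem one_add_ne_zero {v : ℂ} (hv : 0 ≤ v.re) : 1 + v ≠ 0 :=
  Complex.slitPlane_ne_zero (one_add_mem_slitPlane hv)

theorem normSq_one_add_sub (v : ℂ) : ‖1 + v‖ ^ 2 - ‖1 - v‖ ^ 2 = 4 * v.re := by
  rw [← Complex.normSq_eq_norm_sq, ← Complex.normSq_eq_norm_sq, Complex.normSq_apply,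
    Complex.normSq_apply]
  simp
  ring

theorem cayley_mem_closedBall {v : ℂ} (hv : 0 ≤ v.re) :
    (1 - v) / (1 + v) ∈ closedBall (0 : ℂ) 1 := by
  have h := normSq_one_add_sub v
  rw [mem_closedBall_zero_iff, norm_div,
    div_le_one (norm_pos_iff.2 (one_add_ne_zero hv))]
  exact le_of_pow_le_pow_left₀ two_ne_zero (norm_nonneg _) (by linarith)

theorem cayley_mem_ball {v : ℂ} (hv : 0 < v.re) : (1 - v) / (1 + v) ∈ ball (0 : ℂ) 1 := by
  have h := normSq_one_add_sub v
  rw [mem_ball_zero_iff, norm_div,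
    div_lt_one (norm_pos_iff.2 (one_add_ne_zero hv.le))]
  exact lt_of_pow_lt_pow_left₀ 2 (norm_nonneg _) (by linarith)

theorem powerFactor_ne_zero (η κ : ℂ) (E : ℂ → ℂ) {v : ℂ} (hv : v ∈ rightHalf) :
    powerFactor η κ E v ≠ 0 :=
  mul_ne_zero (mul_ne_zero (by simp [Complex.cpow_eq_zero_iff, hv.1])
    (by simp [Complex.cpow_eq_zero_iff, one_add_ne_zero hv.2])) (Complex.exp_ne_zero _)

theorem continuousOn_cayley : ContinuousOn (fun v : ℂ => (1 - v) / (1 + v)) {v | 0 ≤ v.re} :=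
  ContinuousOn.div (by fun_prop) (by fun_prop) fun _ hv => one_add_ne_zero hv

theorem continuousOn_powerFactor (η κ : ℂ) {E : ℂ → ℂ} (hE : ContinuousOn E (closedBall 0 1)) :
    ContinuousOn (powerFactor η κ E) rightHalf := by
  refine ContinuousOn.mul (ContinuousOn.mul ?_ ?_) ?_
  · exact continuousOn_id.cpow_const fun v hv => mem_slitPlane_of_mem_rightHalf hv
  · exact ContinuousOn.cpow_const (by fun_prop) fun v hv => one_add_mem_slitPlane hv.2
  · exact Complex.continuous_exp.comp_continuousOn
      (hE.comp (continuousOn_cayley.mono fun v hv => hv.2) fun v hv => cayley_mem_closedBall hv.2)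

theorem differentiableOn_powerFactor (η κ : ℂ) {E : ℂ → ℂ} (hE : DifferentiableOn ℂ E (ball 0 1)) :
    DifferentiableOn ℂ (powerFactor η κ E) {v | 0 < v.re} := by
  refine DifferentiableOn.mul (DifferentiableOn.mul ?_ ?_) ?_
  · exact differentiableOn_id.cpow_const fun v hv => Or.inl hv
  · exact DifferentiableOn.cpow_const (by fun_prop) fun v hv => one_add_mem_slitPlane (le_of_lt hv)
  · exact Complex.differentiable_exp.comp_differentiableOn (hE.comp
      (DifferentiableOn.div (by fun_prop) (by fun_prop) fun v hv => one_add_ne_zero (le_of_lt hv))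
      fun v hv => cayley_mem_ball hv)

theorem tendsto_powerFactor_zero (η κ : ℂ) {E : ℂ → ℂ} (hE : ContinuousOn E (closedBall 0 1)) :
    Tendsto (fun v => powerFactor η κ E v / v ^ η) (𝓝 0 ⊓ 𝓟 rightHalf)
      (𝓝 (Complex.exp (E 1))) := by
  have hc : ContinuousOn (fun v : ℂ => (1 + v) ^ κ * Complex.exp (E ((1 - v) / (1 + v))))
      {v | 0 ≤ v.re} := by
    refine ContinuousOn.mul ?_ ?_
    · exact ContinuousOn.cpow_const (by fun_prop) fun v hv => one_add_mem_slitPlane hv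
    · exact Complex.continuous_exp.comp_continuousOn
        (hE.comp continuousOn_cayley fun v hv => cayley_mem_closedBall hv)
  have h0 := (hc 0 (by simp)).tendsto
  simp only [add_zero, Complex.one_cpow, sub_zero, div_one, one_mul] at h0
  have h1 : Tendsto (fun v : ℂ => (1 + v) ^ κ * Complex.exp (E ((1 - v) / (1 + v))))
      (𝓝 0 ⊓ 𝓟 rightHalf) (𝓝 (Complex.exp (E 1))) :=
    h0.mono_left (inf_le_inf_left _ (principal_mono.2 fun v hv => hv.2))
  refine h1.congr' ?_
  filter_upwards [mem_inf_of_right (mem_principal_self rightHalf)] with v hv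
  have : v ^ η ≠ 0 := by simp [Complex.cpow_eq_zero_iff, hv.1]
  rw [powerFactor]
  field_simp

theorem inv_re_nonneg {v : ℂ} (hv : 0 ≤ v.re) : 0 ≤ v⁻¹.re := by
  rw [Complex.inv_re]
  exact div_nonneg hv (Complex.normSq_nonneg v)

/-- The arguments of v and 1 + 1/v are at most π/2 in modulus, the second strictly less, so the
principal logarithms add. -/
theorem one_add_cpow_eq {v : ℂ} (hv : v ∈ rightHalf) (κ : ℂ) :
    (1 + v) ^ κ = v ^ κ * (1 + v⁻¹) ^ κ := by
  have e : 1 + v = v * (1 + v⁻¹) := by rw [mul_add, mul_one, mul_inv_cancel₀ hv.1, add_comm]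
  have h1 : |v.arg| ≤ Real.pi / 2 := Complex.abs_arg_le_pi_div_two_iff.2 hv.2
  have h2 : |(1 + v⁻¹).arg| < Real.pi / 2 := by
    refine Complex.abs_arg_lt_pi_div_two_iff.2 (Or.inl ?_)
    have := inv_re_nonneg hv.2
    rw [Complex.add_re, Complex.one_re]
    linarith
  rw [abs_le] at h1
  rw [abs_lt] at h2
  have h3 : 1 + v⁻¹ ≠ 0 := one_add_ne_zero (inv_re_nonneg hv.2)
  rw [e, Complex.cpow_def_of_ne_zero (mul_ne_zero hv.1 h3), Complex.cpow_def_of_ne_zero hv.1,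
    Complex.cpow_def_of_ne_zero h3,
    Complex.log_mul hv.1 h3 ⟨by linarith [Real.pi_pos], by linarith [Real.pi_pos]⟩, add_mul,
    Complex.exp_add]

/-- The inversion v ↦ 1/v preserves the half-plane and changes the sign of the Cayley transform,
which reduces the claim to continuity at 0. -/
theorem tendsto_powerFactor_cobounded (η κ : ℂ) {E : ℂ → ℂ}
    (hE : ContinuousOn E (closedBall 0 1)) :
    Tendsto (fun v => powerFactor η κ E v / v ^ (η + κ)) (Bornology.cobounded ℂ ⊓ 𝓟 rightHalf)
      (𝓝 (Complex.exp (E (-1)))) := by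
  have hinv : Tendsto (fun v : ℂ => v⁻¹) (Bornology.cobounded ℂ ⊓ 𝓟 rightHalf)
      (𝓝[{v | 0 ≤ v.re}] 0) := by
    refine tendsto_nhdsWithin_iff.2
      ⟨(tendsto_inv₀_cobounded (α := ℂ)).mono_left inf_le_left, ?_⟩
    filter_upwards [mem_inf_of_right (mem_principal_self rightHalf)] with v hv
    exact inv_re_nonneg hv.2
  have hc : ContinuousOn (fun v : ℂ => (1 + v) ^ κ * Complex.exp (E (-((1 - v) / (1 + v)))))
      {v | 0 ≤ v.re} := by
    refine ContinuousOn.mul ?_ ?_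
    · exact ContinuousOn.cpow_const (by fun_prop) fun v hv => one_add_mem_slitPlane hv
    · exact Complex.continuous_exp.comp_continuousOn
        (hE.comp continuousOn_cayley.neg fun v hv => by
          have := cayley_mem_closedBall (v := v) hv
          rw [mem_closedBall_zero_iff] at this ⊢
          rwa [norm_neg])
  have h0 := ((hc 0 (by simp)).tendsto.comp hinv)
  simp only [add_zero, Complex.one_cpow, sub_zero, div_one, one_mul] at h0
  refine h0.congr' ?_
  filter_upwards [mem_inf_of_right (mem_principal_self rightHalf)] with v hv
  have e : -((1 - v⁻¹) / (1 + v⁻¹)) = (1 - v) / (1 + v) := by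
    have h1 := one_add_ne_zero (inv_re_nonneg hv.2)
    have h2 := one_add_ne_zero hv.2
    have h3 := hv.1
    rw [neg_eq_iff_add_eq_zero, div_add_div _ _ h1 h2, div_eq_zero_iff]
    left
    field_simp
    ring
  have hη : v ^ η ≠ 0 := by simp [Complex.cpow_eq_zero_iff, hv.1]
  have hκ : v ^ κ ≠ 0 := by simp [Complex.cpow_eq_zero_iff, hv.1]
  simp only [Function.comp, e]
  rw [powerFactor, one_add_cpow_eq hv, Complex.cpow_add _ _ hv.1]
  field_simp

/-- With κ purely imaginary, |(1 + v)^κ| depends only on a bounded argument; E is bounded on the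
compact disc. Only |v|^Re η remains unbounded. -/
theorem exists_norm_powerFactor_bounds (η : ℂ) {κ : ℂ} (hκ : κ.re = 0) {E : ℂ → ℂ}
    (hE : ContinuousOn E (closedBall 0 1)) :
    ∃ C > 0, ∀ v ∈ rightHalf, ‖powerFactor η κ E v‖ ≤ C * ‖v‖ ^ η.re ∧
      ‖v‖ ^ η.re ≤ C * ‖powerFactor η κ E v‖ := by
  obtain ⟨M, hM⟩ := (isCompact_closedBall (0 : ℂ) 1).exists_bound_of_continuousOn hE
  set N := Real.pi * |η.im| + Real.pi * |κ.im| + M with hN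
  refine ⟨Real.exp N, Real.exp_pos _, fun v hv => ?_⟩
  have h1 : ∀ (w ρ : ℂ), |w.arg * ρ.im| ≤ Real.pi * |ρ.im| := fun w ρ => by
    rw [abs_mul]
    exact mul_le_mul_of_nonneg_right (Complex.abs_arg_le_pi w) (abs_nonneg _)
  have h2 := abs_le.1 ((Complex.abs_re_le_norm _).trans (hM _ (cayley_mem_closedBall hv.2)))
  have h3 := abs_le.1 (h1 v η)
  have h4 := abs_le.1 (h1 (1 + v) κ)
  have e : ‖powerFactor η κ E v‖ = ‖v‖ ^ η.re *
      Real.exp (-(v.arg * η.im) - (1 + v).arg * κ.im + (E ((1 - v) / (1 + v))).re) := by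
    rw [powerFactor, norm_mul, norm_mul, Complex.norm_exp, Complex.norm_cpow_of_ne_zero hv.1,
      Complex.norm_cpow_of_ne_zero (one_add_ne_zero hv.2), hκ, Real.rpow_zero, Real.exp_add,
      Real.exp_sub, Real.exp_neg]
    ring
  have hpos : 0 ≤ ‖v‖ ^ η.re := by positivity
  rw [e]
  constructor
  · rw [mul_comm]
    gcongr
    linarith
  · rw [mul_left_comm, ← Real.exp_add]
    refine le_mul_of_one_le_right hpos (Real.one_le_exp ?_)
    linarith

/-! ### Admissible exponents and uniqueness of solutions. -/

/-- The exponent of `‖z‖` in the bound `C / ‖p.coord z‖ ^ η`. -/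
def SingularPoint.growthExponent : SingularPoint → ℝ → ℝ
  | .zero, η => -η
  | .infty, η => η

theorem SingularPoint.div_norm_coord_rpow (p : SingularPoint) (C η : ℝ) (z : ℂ) :
    C / ‖p.coord z‖ ^ η = C * ‖z‖ ^ p.growthExponent η := by
  cases p
  · simp only [SingularPoint.coord, SingularPoint.growthExponent]
    rw [Real.rpow_neg (norm_nonneg _), div_eq_mul_inv]
  · simp only [SingularPoint.coord, SingularPoint.growthExponent]
    rw [norm_inv, Real.inv_rpow (norm_nonneg _), div_eq_mul_inv, inv_inv]

theorem SingularPoint.growthExponent_mem (p : SingularPoint) {η : ℝ} (h0 : 0 ≤ η) (h1 : η < 1) :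
    p.growthExponent η ∈ p.exponentRange := by
  cases p
  · exact ⟨neg_lt_neg h1, neg_nonpos.2 h0⟩
  · exact ⟨h0, h1⟩

theorem SingularPoint.exists_growthExponent_eq (p : SingularPoint) {ρ : ℝ}
    (h : ρ ∈ p.exponentRange) : ∃ η, 0 ≤ η ∧ η < 1 ∧ p.growthExponent η = ρ := by
  cases p
  · exact ⟨-ρ, neg_nonneg.2 h.2, by linarith [h.1], neg_neg ρ⟩
  · exact ⟨ρ, h.1, h.2, rfl⟩

/-- The range is a half-open interval of length 1, so differences are strictly below 1 in modulus.
This strictness is what the Liouville argument requires. -/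
theorem SingularPoint.abs_sub_lt_one (p : SingularPoint) {ρ σ : ℝ}
    (hρ : ρ ∈ p.exponentRange) (hσ : σ ∈ p.exponentRange) : -1 < ρ - σ ∧ ρ - σ < 1 := by
  cases p
  · exact ⟨by linarith [hρ.1, hσ.2], by linarith [hσ.1, hρ.2]⟩
  · exact ⟨by linarith [hρ.1, hσ.2], by linarith [hσ.1, hρ.2]⟩

theorem SingularPoint.exists_add_int_mem (p : SingularPoint) (x : ℝ) :
    ∃ n : ℤ, x + n ∈ p.exponentRange := by
  cases p
  · obtain ⟨n, hn, -⟩ := existsUnique_add_zsmul_mem_Ioc (one_pos : (0 : ℝ) < 1) x (-1)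
    exact ⟨n, by simpa [SingularPoint.exponentRange] using hn⟩
  · obtain ⟨n, hn, -⟩ := existsUnique_add_zsmul_mem_Ico (one_pos : (0 : ℝ) < 1) x 0
    exact ⟨n, by simpa [SingularPoint.exponentRange] using hn⟩

theorem mul_mem_leftClosed {u : ℂ} (hu : u ≠ 0) {w : ℂ} (hw : w ≠ 0) (h : 0 ≤ w.im) :
    u * w ∈ leftClosed u :=
  ⟨mul_ne_zero hu hw, by rwa [mul_div_cancel_left₀ _ hu]⟩

theorem mul_mem_rightClosed {u : ℂ} (hu : u ≠ 0) {w : ℂ} (hw : w ≠ 0) (h : w.im ≤ 0) :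
    u * w ∈ rightClosed u :=
  ⟨mul_ne_zero hu hw, by rwa [mul_div_cancel_left₀ _ hu]⟩

theorem leftOpen_subset (u : ℂ) : leftOpen u ⊆ leftClosed u := fun z hz =>
  ⟨fun h => by simp [leftOpen, h] at hz, le_of_lt hz⟩

theorem rightOpen_subset (u : ℂ) : rightOpen u ⊆ rightClosed u := fun z hz =>
  ⟨fun h => by simp [rightOpen, h] at hz, le_of_lt hz⟩

theorem mul_mem_leftOpen {u : ℂ} (hu : u ≠ 0) {w : ℂ} (h : 0 < w.im) : u * w ∈ leftOpen u := by
  rw [leftOpen, mem_ofPred_eq, mul_div_cancel_left₀ _ hu]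
  exact h

theorem mul_mem_rightOpen {u : ℂ} (hu : u ≠ 0) {w : ℂ} (h : w.im < 0) : u * w ∈ rightOpen u := by
  rw [rightOpen, mem_ofPred_eq, mul_div_cancel_left₀ _ hu]
  exact h

/-- Solutions of the homogeneous problem are multiples of any nonvanishing solution that is
bounded below by a power with an admissible exponent. -/
theorem IsSolution.exists_eq_const_mul {u : ℂ} (hu : ‖u‖ = 1) {G : ℂ → ℂ} {p : SingularPoint}
    {Xp Xm Yp Ym : ℂ → ℂ} (hX : IsSolution u G p Xp Xm) (hY : IsSolution u G p Yp Ym)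
    (hG : ∀ t : ℝ, t ≠ 0 → G (t * u) ≠ 0)
    (hXp : ∀ z ∈ leftClosed u, Xp z ≠ 0) (hXm : ∀ z ∈ rightClosed u, Xm z ≠ 0)
    {ρ C : ℝ} (hρ : ρ ∈ p.exponentRange)
    (hbp : ∀ z ∈ leftClosed u, ‖z‖ ^ ρ ≤ C * ‖Xp z‖)
    (hbm : ∀ z ∈ rightClosed u, ‖z‖ ^ ρ ≤ C * ‖Xm z‖) :
    ∃ c : ℂ, (∀ z ∈ leftClosed u, Yp z = c * Xp z) ∧ (∀ z ∈ rightClosed u, Ym z = c * Xm z) := by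
  have hu0 : u ≠ 0 := norm_pos_iff.1 (by rw [hu]; exact one_pos)
  obtain ⟨M, η, hη0, hη1, hMp, hMm⟩ := hY.growth
  simp only [SingularPoint.div_norm_coord_rpow] at hMp hMm
  set σ := p.growthExponent η with hσ
  have hσm : σ ∈ p.exponentRange := p.growthExponent_mem hη0 hη1
  -- The quotient of the two solutions, with the line rotated to the real axis; on the axis the
  -- factor G cancels, so the two definitions agree there.
  set Q : ℂ → ℂ := fun w =>
    if 0 ≤ w.im then Yp (u * w) / Xp (u * w) else Ym (u * w) / Xm (u * w) with hQ
  have hmul : ∀ s : Set ℂ, ContinuousOn (fun w : ℂ => u * w) s := fun s => by fun_prop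
  have hagree : ∀ w : ℂ, w ≠ 0 → w.im = 0 →
      Yp (u * w) / Xp (u * w) = Ym (u * w) / Xm (u * w) := by
    intro w hw him
    have hw' : w = (w.re : ℂ) := Complex.ext rfl (by simpa using him)
    have hre : w.re ≠ 0 := fun h => hw (by rw [hw', h, Complex.ofReal_zero])
    have e : u * w = w.re * u := by rw [mul_comm, ← hw']
    rw [e, hX.boundary _ hre, hY.boundary _ hre, mul_div_mul_left _ _ (hG _ hre)]
  have hQm : ∀ w : ℂ, w ≠ 0 → w.im ≤ 0 → Q w = Ym (u * w) / Xm (u * w) := by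
    intro w hw him
    by_cases h : 0 ≤ w.im
    · simp only [hQ, if_pos h]
      exact hagree w hw (le_antisymm him h)
    · simp only [hQ, if_neg h]
  have hc : ContinuousOn Q {0}ᶜ := by
    refine ContinuousOn.if ?_ ?_ ?_
    · rintro w ⟨hw, hf⟩
      rw [Complex.frontier_setOfPred_le_im] at hf
      exact hagree w hw hf
    · rw [(isClosed_le continuous_const Complex.continuous_im).closure_eq]
      have hm : MapsTo (fun w => u * w) ({0}ᶜ ∩ {w : ℂ | 0 ≤ w.im}) (leftClosed u) :=
        fun w hw => mul_mem_leftClosed hu0 hw.1 hw.2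
      exact (hY.continuous_left.comp (hmul _) hm).div (hX.continuous_left.comp (hmul _) hm)
        fun w hw => hXp _ (hm hw)
    · simp only [not_le]
      rw [Complex.closure_setOfPred_im_lt]
      have hm : MapsTo (fun w => u * w) ({0}ᶜ ∩ {w : ℂ | w.im ≤ 0}) (rightClosed u) :=
        fun w hw => mul_mem_rightClosed hu0 hw.1 hw.2
      exact (hY.continuous_right.comp (hmul _) hm).div (hX.continuous_right.comp (hmul _) hm)
        fun w hw => hXm _ (hm hw)
  have hdm : ∀ s : Set ℂ, DifferentiableOn ℂ (fun w : ℂ => u * w) s := fun s => by fun_prop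
  have hp : DifferentiableOn ℂ Q {z | 0 < z.im} := by
    have hm : MapsTo (fun w => u * w) {w : ℂ | 0 < w.im} (leftOpen u) :=
      fun w hw => mul_mem_leftOpen hu0 hw
    refine ((hY.analytic_left.comp (hdm _) hm).div (hX.analytic_left.comp (hdm _) hm)
      fun w hw => hXp _ (leftOpen_subset u (hm hw))).congr fun w hw => ?_
    exact if_pos (le_of_lt hw)
  have hmn : DifferentiableOn ℂ Q {z | z.im < 0} := by
    have hm : MapsTo (fun w => u * w) {w : ℂ | w.im < 0} (rightOpen u) :=
      fun w hw => mul_mem_rightOpen hu0 hw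
    refine ((hY.analytic_right.comp (hdm _) hm).div (hX.analytic_right.comp (hdm _) hm)
      fun w hw => hXm _ (rightOpen_subset u (hm hw))).congr fun w hw => ?_
    exact if_neg (not_le.2 hw)
  have hquot : ∀ (w y x : ℂ), w ≠ 0 → x ≠ 0 → ‖y‖ < M * ‖u * w‖ ^ σ → ‖u * w‖ ^ ρ ≤ C * ‖x‖ →
      ‖y / x‖ ≤ M * C * ‖w‖ ^ (σ - ρ) := by
    intro w y x hw hx hy hxw
    rw [norm_mul, hu, one_mul] at hy hxw
    have hw' : 0 < ‖w‖ := norm_pos_iff.2 hw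
    have hx' : 0 < ‖x‖ := norm_pos_iff.2 hx
    have hσ' : 0 < ‖w‖ ^ σ := Real.rpow_pos_of_pos hw' _
    have hρ' : 0 < ‖w‖ ^ ρ := Real.rpow_pos_of_pos hw' _
    have hM : 0 ≤ M := by
      by_contra! h
      nlinarith [norm_nonneg y]
    rw [norm_div, div_le_iff₀ hx', Real.rpow_sub hw']
    have h1 : M * C * (‖w‖ ^ σ / ‖w‖ ^ ρ) * ‖x‖ = M * ‖w‖ ^ σ * ((C * ‖x‖) / ‖w‖ ^ ρ) := by ring
    rw [h1]
    have h2 : 1 ≤ C * ‖x‖ / ‖w‖ ^ ρ := (one_le_div hρ').2 hxw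
    exact hy.le.trans (le_mul_of_one_le_right (by positivity) h2)
  obtain ⟨h1, h2⟩ := p.abs_sub_lt_one hσm hρ
  obtain ⟨c, hcQ⟩ := exists_eq_const_of_off_real hc hp hmn (C := M * C) h1 h2 fun w hw => by
    by_cases h : 0 ≤ w.im
    · have hz := mul_mem_leftClosed hu0 hw h
      simp only [hQ, if_pos h]
      exact hquot w _ _ hw (hXp _ hz) (hMp _ hz) (hbp _ hz)
    · have hz := mul_mem_rightClosed hu0 hw (not_le.1 h).le
      simp only [hQ, if_neg h]
      exact hquot w _ _ hw (hXm _ hz) (hMm _ hz) (hbm _ hz)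
  refine ⟨c, fun z hz => ?_, fun z hz => ?_⟩
  · have h3 := hcQ (z / u) (div_ne_zero hz.1 hu0)
    simp only [hQ, if_pos hz.2, mul_div_cancel₀ _ hu0] at h3
    exact (div_eq_iff (hXp z hz)).1 h3
  · have h3 := hcQ (z / u) (div_ne_zero hz.1 hu0)
    rw [hQm _ (div_ne_zero hz.1 hu0) hz.2, mul_div_cancel₀ _ hu0] at h3
    exact (div_eq_iff (hXm z hz)).1 h3

/-! ### Logarithms of the coefficient in the angular variable. -/

theorem IsHolderOn.mono_const {K K' μ : ℝ} {f : ℝ → ℂ} {S : Set ℝ} (h : IsHolderOn K μ f S)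
    (hK : K ≤ K') : IsHolderOn K' μ f S := fun s hs t ht =>
  (h s hs t ht).trans (mul_le_mul_of_nonneg_right hK (by positivity))

/-- A continuous logarithm of a Hölder continuous function with nonzero limits at the ends of a
bounded interval extends to a Hölder continuous function on the closed interval. -/
theorem IsHolderOn.exists_log_extension {K μ : ℝ} {f ψ : ℝ → ℂ} {a b : ℝ} {la lb : ℂ} (hab : a < b)
    (h : IsHolderOn K μ f (Ioo a b)) (hK : 0 ≤ K) (hμ : 0 < μ)
    (ha : Tendsto f (𝓝[>] a) (𝓝 la)) (hb : Tendsto f (𝓝[<] b) (𝓝 lb)) (hla : la ≠ 0) (hlb : lb ≠ 0)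
    (hψ : ContinuousOn ψ (Ioo a b)) (he : ∀ r ∈ Ioo a b, Complex.exp (ψ r) = f r) :
    ∃ (F : ℝ → ℂ) (K' : ℝ), 0 ≤ K' ∧ EqOn F ψ (Ioo a b) ∧ IsHolderOn K' μ F (Icc a b) ∧
      ContinuousOn F (Icc a b) ∧ Complex.exp (F a) = la ∧ Complex.exp (F b) = lb := by
  have hfc := (h.uniformContinuousOn hμ).continuousOn
  have hext := continuousOn_Icc_extendFrom_Ioo hfc ha hb
  have hne : ∀ r ∈ Icc a b, extendFrom (Ioo a b) f r ≠ 0 := by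
    intro r hr
    rcases eq_endpoints_or_mem_Ioo_of_mem_Icc hr with rfl | rfl | hr
    · rwa [eq_lim_at_left_extendFrom_Ioo hab ha]
    · rwa [eq_lim_at_right_extendFrom_Ioo hab hb]
    · rw [extendFrom_extends hfc _ hr, ← he r hr]
      exact Complex.exp_ne_zero _
  -- The extension of f by its nonzero limits has no zero on the compact interval; its minimum
  -- modulus is the lower bound needed for the logarithm.
  obtain ⟨x, hx, hmin⟩ := isCompact_Icc.exists_isMinOn (nonempty_Icc.2 hab.le) hext.norm
  obtain ⟨K', hK', hψK⟩ := h.exists_log hK hμ (norm_pos_iff.2 (hne x hx)) (fun r hr => by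
    rw [← extendFrom_extends hfc r hr]
    exact hmin (Ioo_subset_Icc_self hr)) hψ he
  obtain ⟨F, hFψ, hFH, hFc⟩ := hψK.exists_extension hab hμ
  have hexp : EqOn (fun r => Complex.exp (F r)) f (Ioo a b) := fun r hr => by
    simp only [hFψ hr, he r hr]
  have hFe : ContinuousOn (fun r => Complex.exp (F r)) (Icc a b) :=
    Complex.continuous_exp.comp_continuousOn hFc
  refine ⟨F, K', hK', hFψ, hFH, hFc, ?_, ?_⟩
  · have h1 := ((hFe a (left_mem_Icc.2 hab.le)).mono Ioo_subset_Icc_self).tendsto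
    rw [nhdsWithin_Ioo_eq_nhdsGT hab] at h1
    refine tendsto_nhds_unique h1 (ha.congr' ?_)
    filter_upwards [Ioo_mem_nhdsGT hab] with r hr using (hexp hr).symm
  · have h1 := ((hFe b (right_mem_Icc.2 hab.le)).mono Ioo_subset_Icc_self).tendsto
    rw [nhdsWithin_Ioo_eq_nhdsLT hab] at h1
    refine tendsto_nhds_unique h1 (hb.congr' ?_)
    filter_upwards [Ioo_mem_nhdsLT hab] with r hr using (hexp hr).symm

/-- Here 1/√(1 + tan²) is the cosine, and the addition theorem for the sine does the rest; hence the
chordal metric is dominated by the angle. -/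
theorem chordal_tan {x y : ℝ} (hx : 0 < Real.cos x) (hy : 0 < Real.cos y) :
    chordal (Real.tan x) (Real.tan y) = |Real.sin (x - y)| := by
  rw [chordal, div_eq_mul_inv, mul_inv, Real.inv_sqrt_one_add_tan_sq hx,
    Real.inv_sqrt_one_add_tan_sq hy, Real.tan_eq_sin_div_cos, Real.tan_eq_sin_div_cos,
    div_sub_div _ _ hx.ne' hy.ne', abs_div, abs_of_pos (mul_pos hx hy), Real.sin_sub]
  field_simp

theorem cos_half_pos {a : ℝ} (ha : a ∈ Ioo (-Real.pi) Real.pi) : 0 < Real.cos (a / 2) :=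
  Real.cos_pos_of_mem_Ioo ⟨by linarith [ha.1], by linarith [ha.2]⟩

theorem chordal_tan_half_le {a b : ℝ} (ha : a ∈ Ioo (-Real.pi) Real.pi)
    (hb : b ∈ Ioo (-Real.pi) Real.pi) :
    chordal (Real.tan (a / 2)) (Real.tan (b / 2)) ≤ |a - b| := by
  rw [chordal_tan (cos_half_pos ha) (cos_half_pos hb)]
  refine Real.abs_sin_le_abs.trans ?_
  rw [← sub_div, abs_div, abs_two]
  linarith [abs_nonneg (a - b)]

theorem chordal_nonneg (s t : ℝ) : 0 ≤ chordal s t := by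
  rw [chordal]
  positivity

theorem isHolderOn_comp_tan_half {u : ℂ} {G : ℂ → ℂ} {K μ : ℝ} (hμ : 0 < μ)
    (h : ∀ s t : ℝ, 0 < s * t → ‖G (s * u) - G (t * u)‖ ≤ K * chordal s t ^ μ) {S : Set ℝ}
    (hS : S ⊆ Ioo (-Real.pi) Real.pi)
    (hsign : ∀ a ∈ S, ∀ b ∈ S, 0 < Real.tan (a / 2) * Real.tan (b / 2)) :
    IsHolderOn |K| μ (fun a => G (Real.tan (a / 2) * u)) S := by
  intro a ha b hb
  refine (h _ _ (hsign a ha b hb)).trans ?_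
  have h1 := chordal_nonneg (Real.tan (a / 2)) (Real.tan (b / 2))
  have h2 := chordal_tan_half_le (hS ha) (hS hb)
  calc _ ≤ |K| * chordal (Real.tan (a / 2)) (Real.tan (b / 2)) ^ μ :=
        mul_le_mul_of_nonneg_right (le_abs_self K) (by positivity)
    _ ≤ _ := by gcongr

theorem tan_half_pos {a : ℝ} (ha : a ∈ Ioo 0 Real.pi) : 0 < Real.tan (a / 2) :=
  Real.tan_pos_of_pos_of_lt_pi_div_two (by linarith [ha.1]) (by linarith [ha.2])

theorem tan_half_neg {a : ℝ} (ha : a ∈ Ioo (-Real.pi) 0) : Real.tan (a / 2) < 0 :=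
  Real.tan_neg_of_neg_of_pi_div_two_lt (by linarith [ha.2]) (by linarith [ha.1])

theorem continuousOn_tan_half : ContinuousOn (fun a : ℝ => Real.tan (a / 2))
    (Ioo (-Real.pi) Real.pi) := fun a ha =>
  ((Real.continuousAt_tan.2 (cos_half_pos ha).ne').comp (f := fun a : ℝ => a / 2)
    (by fun_prop)).continuousWithinAt

theorem tendsto_tan_half_zero_right :
    Tendsto (fun a : ℝ => Real.tan (a / 2)) (𝓝[>] 0) (𝓝[>] 0) := by
  refine tendsto_nhdsWithin_iff.2 ⟨?_, ?_⟩
  · have h := (continuousOn_tan_half.continuousAt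
      (Ioo_mem_nhds (neg_lt_zero.2 Real.pi_pos) Real.pi_pos)).tendsto
    simp only [zero_div, Real.tan_zero] at h
    exact h.mono_left inf_le_left
  · filter_upwards [Ioo_mem_nhdsGT Real.pi_pos] with a ha using tan_half_pos ha

theorem tendsto_tan_half_zero_left :
    Tendsto (fun a : ℝ => Real.tan (a / 2)) (𝓝[<] 0) (𝓝[<] 0) := by
  refine tendsto_nhdsWithin_iff.2 ⟨?_, ?_⟩
  · have h := (continuousOn_tan_half.continuousAt
      (Ioo_mem_nhds (neg_lt_zero.2 Real.pi_pos) Real.pi_pos)).tendsto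
    simp only [zero_div, Real.tan_zero] at h
    exact h.mono_left inf_le_left
  · filter_upwards [Ioo_mem_nhdsLT (neg_lt_zero.2 Real.pi_pos)] with a ha using tan_half_neg ha

theorem tendsto_tan_half_pi :
    Tendsto (fun a : ℝ => Real.tan (a / 2)) (𝓝[<] Real.pi) atTop := by
  refine Real.tendsto_tan_pi_div_two.comp (tendsto_nhdsWithin_iff.2 ⟨?_, ?_⟩)
  · exact ((continuous_id.div_const (2 : ℝ)).tendsto Real.pi).mono_left inf_le_left
  · filter_upwards [self_mem_nhdsWithin] with a ha
    simp only [mem_Iio] at ha ⊢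
    linarith

theorem tendsto_tan_half_neg_pi :
    Tendsto (fun a : ℝ => Real.tan (a / 2)) (𝓝[>] (-Real.pi)) atBot := by
  refine Real.tendsto_tan_neg_pi_div_two.comp (tendsto_nhdsWithin_iff.2 ⟨?_, ?_⟩)
  · have h : Tendsto (fun a : ℝ => a / 2) (𝓝[>] (-Real.pi)) (𝓝 (-Real.pi / 2)) :=
      ((continuous_id.div_const (2 : ℝ)).tendsto (-Real.pi)).mono_left inf_le_left
    rwa [neg_div] at h
  · filter_upwards [self_mem_nhdsWithin] with a ha
    simp only [mem_Ioi] at ha ⊢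
    linarith

/-- The two branches of the logarithm of the coefficient, in the variable `a` with
`t = tan (a / 2)`, normalised by the vanishing of the index. -/
structure IsLogPair (u : ℂ) (G : ℂ → ℂ) (zeroPlus zeroMinus inftyPlus inftyMinus : ℂ)
    (K μ : ℝ) (F₁ F₂ : ℝ → ℂ) : Prop where
  holder₁ : IsHolderOn K μ F₁ (Icc 0 Real.pi)
  holder₂ : IsHolderOn K μ F₂ (Icc (-Real.pi) 0)
  exp₁ : ∀ a ∈ Ioo 0 Real.pi, Complex.exp (F₁ a) = G (Real.tan (a / 2) * u)
  exp₂ : ∀ a ∈ Ioo (-Real.pi) 0, Complex.exp (F₂ a) = G (Real.tan (a / 2) * u)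
  exp_zeroPlus : Complex.exp (F₁ 0) = zeroPlus
  exp_zeroMinus : Complex.exp (F₂ 0) = zeroMinus
  exp_inftyMinus : Complex.exp (F₁ Real.pi) = inftyMinus
  exp_inftyPlus : Complex.exp (F₂ (-Real.pi)) = inftyPlus
  index : ((F₁ Real.pi).im - (F₁ 0).im) + ((F₂ 0).im - (F₂ (-Real.pi)).im) = 0

theorem exists_isLogPair {u : ℂ} {G : ℂ → ℂ} {zeroPlus zeroMinus inftyPlus inftyMinus : ℂ}
    (hG : IsJumpCoefficient u G zeroPlus zeroMinus inftyPlus inftyMinus)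
    (hindex : HasZeroIndex u G) :
    ∃ (K μ : ℝ) (F₁ F₂ : ℝ → ℂ), 0 ≤ K ∧ 0 < μ ∧ μ ≤ 1 ∧
      IsLogPair u G zeroPlus zeroMinus inftyPlus inftyMinus K μ F₁ F₂ := by
  obtain ⟨K, μ, hμ, hμ1, hH⟩ := hG.holder
  obtain ⟨φ, hφc, hφ, hφi⟩ := hindex
  have hpi := Real.pi_pos
  set f : ℝ → ℂ := fun a => G (Real.tan (a / 2) * u) with hf
  -- The logarithm is built from the argument φ given by the index hypothesis, so that the imaginary
  -- parts of F₁ and F₂ inherit the vanishing index.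
  set ψ : ℝ → ℂ := fun a => (Real.log ‖f a‖ : ℂ) + φ (Real.tan (a / 2)) * Complex.I with hψ
  have hs₁ : Ioo 0 Real.pi ⊆ Ioo (-Real.pi) Real.pi := Ioo_subset_Ioo_left (by linarith)
  have hs₂ : Ioo (-Real.pi) 0 ⊆ Ioo (-Real.pi) Real.pi := Ioo_subset_Ioo_right hpi.le
  have hf₁ : IsHolderOn |K| μ f (Ioo 0 Real.pi) := isHolderOn_comp_tan_half hμ hH hs₁
    fun a ha b hb => mul_pos (tan_half_pos ha) (tan_half_pos hb)
  have hf₂ : IsHolderOn |K| μ f (Ioo (-Real.pi) 0) := isHolderOn_comp_tan_half hμ hH hs₂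
    fun a ha b hb => mul_pos_of_neg_of_neg (tan_half_neg ha) (tan_half_neg hb)
  have hexp : ∀ a, Real.tan (a / 2) ≠ 0 → Complex.exp (ψ a) = f a := by
    intro a ha
    have h0 := norm_pos_iff.2 (hG.ne_zero _ ha)
    simp only [hψ]
    rw [Complex.exp_add, ← Complex.ofReal_exp, Real.exp_log h0]
    exact (hφ _ ha).symm
  have hcont : ∀ S ⊆ Ioo (-Real.pi) Real.pi, (∀ a ∈ S, Real.tan (a / 2) ≠ 0) →
      ContinuousOn f S → ContinuousOn ψ S := by
    intro S hS hne hfS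
    have h1 : ContinuousOn (fun a => Real.log ‖f a‖) S := hfS.norm.log fun a ha =>
      norm_ne_zero_iff.2 (hG.ne_zero _ (hne a ha))
    have h2 : ContinuousOn (fun a => φ (Real.tan (a / 2))) S :=
      hφc.comp (continuousOn_tan_half.mono hS) fun a ha => hne a ha
    exact (Complex.continuous_ofReal.comp_continuousOn h1).add
      ((Complex.continuous_ofReal.comp_continuousOn h2).mul continuousOn_const)
  have hne₁ : ∀ a ∈ Ioo 0 Real.pi, Real.tan (a / 2) ≠ 0 := fun a ha => (tan_half_pos ha).ne'
  have hne₂ : ∀ a ∈ Ioo (-Real.pi) 0, Real.tan (a / 2) ≠ 0 := fun a ha => (tan_half_neg ha).ne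
  obtain ⟨F₁, K₁, hK₁, he₁, hh₁, hc₁, hl₁, hr₁⟩ := hf₁.exists_log_extension hpi (abs_nonneg K) hμ
    (hG.tendsto_zeroPlus.comp tendsto_tan_half_zero_right)
    (hG.tendsto_inftyMinus.comp tendsto_tan_half_pi) hG.zeroPlus_ne hG.inftyMinus_ne
    (hcont _ hs₁ hne₁ (hf₁.uniformContinuousOn hμ).continuousOn) fun a ha => hexp a (hne₁ a ha)
  obtain ⟨F₂, K₂, hK₂, he₂, hh₂, hc₂, hl₂, hr₂⟩ := hf₂.exists_log_extension (neg_lt_zero.2 hpi)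
    (abs_nonneg K) hμ (hG.tendsto_inftyPlus.comp tendsto_tan_half_neg_pi)
    (hG.tendsto_zeroMinus.comp tendsto_tan_half_zero_left) hG.inftyPlus_ne hG.zeroMinus_ne
    (hcont _ hs₂ hne₂ (hf₂.uniformContinuousOn hμ).continuousOn) fun a ha => hexp a (hne₂ a ha)
  refine ⟨max K₁ K₂, μ, F₁, F₂, hK₁.trans (le_max_left _ _), hμ, hμ1,
    hh₁.mono_const (le_max_left _ _), hh₂.mono_const (le_max_right _ _),
    fun a ha => by rw [he₁ ha]; exact hexp a (hne₁ a ha),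
    fun a ha => by rw [he₂ ha]; exact hexp a (hne₂ a ha), hl₁, hr₂, hr₁, hl₂, ?_⟩
  have hψim : ∀ a, (ψ a).im = φ (Real.tan (a / 2)) := fun a => by simp [hψ]
  have hlim : ∀ (F : ℝ → ℂ) (c d : ℝ) (g : ℝ → ℝ), ContinuousOn F (Icc c d) → Continuous g →
      g 0 ∈ Icc c d → (∀ a ∈ Ioo 0 Real.pi, g a ∈ Icc c d) →
      Tendsto (fun a => (F (g a)).im) (𝓝[>] 0) (𝓝 (F (g 0)).im) := by
    intro F c d g hF hg h0 hm
    refine (Complex.continuous_im.tendsto _).comp ((hF _ h0).tendsto.comp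
      (tendsto_nhdsWithin_iff.2 ⟨(hg.tendsto 0).mono_left inf_le_left, ?_⟩))
    filter_upwards [Ioo_mem_nhdsGT hpi] with a ha using hm a ha
  -- With r = tan(a/2), the angles π - a, a, -a, -(π - a) correspond to 1/r, r, -r, -1/r, the four
  -- points in `HasZeroIndex`.
  have l1 := hlim F₁ _ _ (fun a => Real.pi - a) hc₁ (by fun_prop) (by simp [hpi.le])
    fun a ha => ⟨by linarith [ha.2], by linarith [ha.1]⟩
  have l2 := hlim F₁ _ _ (fun a => a) hc₁ (by fun_prop) (by simp [hpi.le])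
    fun a ha => ⟨ha.1.le, ha.2.le⟩
  have l3 := hlim F₂ _ _ (fun a => -a) hc₂ (by fun_prop) (by simp [hpi.le])
    fun a ha => ⟨by linarith [ha.2], by linarith [ha.1]⟩
  have l4 := hlim F₂ _ _ (fun a => -(Real.pi - a)) hc₂ (by fun_prop) (by simp [hpi.le])
    fun a ha => ⟨by linarith [ha.1], by linarith [ha.2]⟩
  have l := (l1.sub l2).add (l3.sub l4)
  simp only [sub_zero, neg_zero] at l
  refine tendsto_nhds_unique l ((hφi.comp tendsto_tan_half_zero_right).congr' ?_)
  filter_upwards [Ioo_mem_nhdsGT hpi] with a ha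
  have m1 : Real.pi - a ∈ Ioo 0 Real.pi := ⟨by linarith [ha.2], by linarith [ha.1]⟩
  have m3 : -a ∈ Ioo (-Real.pi) 0 := ⟨by linarith [ha.2], by linarith [ha.1]⟩
  have m4 : -(Real.pi - a) ∈ Ioo (-Real.pi) 0 := ⟨by linarith [ha.1], by linarith [ha.2]⟩
  have t1 : Real.tan ((Real.pi - a) / 2) = (Real.tan (a / 2))⁻¹ := by
    rw [sub_div, Real.tan_pi_div_two_sub]
  rw [he₁ m1, he₁ ha, he₂ m3, he₂ m4, hψim, hψim, hψim, hψim, neg_div, neg_div, Real.tan_neg,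
    Real.tan_neg, t1]
  rfl

/-! ### From Hölder functions of the angle to Hölder functions on the circle. -/

theorem IsHolderOn.add {K K' μ : ℝ} {f g : ℝ → ℂ} {S : Set ℝ} (hf : IsHolderOn K μ f S)
    (hg : IsHolderOn K' μ g S) : IsHolderOn (K + K') μ (fun a => f a + g a) S := by
  intro s hs t ht
  have e : f s + g s - (f t + g t) = (f s - f t) + (g s - g t) := by ring
  rw [e, add_mul]
  exact (norm_add_le _ _).trans (add_le_add (hf s hs t ht) (hg s hs t ht))

/-- A Lipschitz bound on a bounded set is a Hölder bound, as d = d^(1-μ) d^μ ≤ R^(1-μ) d^μ. -/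
theorem isHolderOn_affine {μ R : ℝ} (hμ1 : μ ≤ 1) (c d : ℂ) {S : Set ℝ}
    (hS : ∀ s ∈ S, ∀ t ∈ S, |s - t| ≤ R) :
    IsHolderOn (‖c‖ * R ^ (1 - μ)) μ (fun a => d + c * a) S := by
  intro s hs t ht
  have e : d + c * s - (d + c * t) = c * ((s - t : ℝ) : ℂ) := by push_cast; ring
  rw [e, norm_mul, Complex.norm_real, Real.norm_eq_abs, mul_assoc]
  refine mul_le_mul_of_nonneg_left ?_ (norm_nonneg c)
  rcases (abs_nonneg (s - t)).eq_or_lt with h0 | h0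
  · rw [← h0]
    have : 0 ≤ R := (abs_nonneg _).trans (hS s hs t ht)
    positivity
  · calc |s - t| = |s - t| ^ (1 - μ) * |s - t| ^ μ := by
          rw [← Real.rpow_add h0, sub_add_cancel, Real.rpow_one]
      _ ≤ _ := by
          have := Real.rpow_le_rpow h0.le (hS s hs t ht) (by linarith : 0 ≤ 1 - μ)
          gcongr

theorem IsHolderOn.union_Icc {K μ : ℝ} {f : ℝ → ℂ} {a b c : ℝ} (hab : a ≤ b) (hbc : b ≤ c)
    (h₁ : IsHolderOn K μ f (Icc a b)) (h₂ : IsHolderOn K μ f (Icc b c)) (hK : 0 ≤ K) (hμ : 0 < μ) :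
    IsHolderOn (2 * K) μ f (Icc a c) := by
  have hK2 : ∀ x y : ℝ, K * |x - y| ^ μ ≤ 2 * K * |x - y| ^ μ := fun x y =>
    mul_le_mul_of_nonneg_right (by linarith) (by positivity)
  have hmix : ∀ s ∈ Icc a b, ∀ t ∈ Icc b c, ‖f s - f t‖ ≤ 2 * K * |s - t| ^ μ := by
    intro s hs t ht
    have e1 := h₁ s hs b (right_mem_Icc.2 hab)
    have e2 := h₂ b (left_mem_Icc.2 hbc) t ht
    have d1 : |s - b| ≤ |s - t| := by
      rw [abs_of_nonpos (by linarith [hs.2]), abs_of_nonpos (by linarith [hs.2, ht.1])]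
      linarith [ht.1]
    have d2 : |b - t| ≤ |s - t| := by
      rw [abs_of_nonpos (by linarith [ht.1]), abs_of_nonpos (by linarith [hs.2, ht.1])]
      linarith [hs.2]
    calc ‖f s - f t‖ ≤ ‖f s - f b‖ + ‖f b - f t‖ := norm_sub_le_norm_sub_add_norm_sub _ _ _
      _ ≤ K * |s - t| ^ μ + K * |s - t| ^ μ := by
          refine add_le_add (e1.trans ?_) (e2.trans ?_) <;> gcongr
      _ = _ := by ring
  intro s hs t ht
  rcases le_total s b with hsb | hsb <;> rcases le_total t b with htb | htb
  · exact (h₁ s ⟨hs.1, hsb⟩ t ⟨ht.1, htb⟩).trans (hK2 s t)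
  · exact hmix s ⟨hs.1, hsb⟩ t ⟨htb, ht.2⟩
  · rw [norm_sub_rev, abs_sub_comm]
    exact hmix t ⟨ht.1, htb⟩ s ⟨hsb, hs.2⟩
  · exact (h₂ s ⟨hsb, hs.2⟩ t ⟨htb, ht.2⟩).trans (hK2 s t)

/-- The shorter arc is at most π/2 times the chord. If it passes through -1, it is split there,
using equality of the end values; the two pieces account for the factor 2. -/
theorem IsHolderOn.comp_arg {K μ : ℝ} {f : ℝ → ℂ} (h : IsHolderOn K μ f (Icc (-Real.pi) Real.pi))
    (hK : 0 ≤ K) (hμ : 0 < μ) (hper : f (-Real.pi) = f Real.pi) :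
    IsHolderOnCircle (2 * K * (Real.pi / 2) ^ μ) μ (fun z => f z.arg) := by
  have hpi := Real.pi_pos
  have hle : ∀ z w : ℂ, ‖z‖ = 1 → ‖w‖ = 1 → w.arg ≤ z.arg →
      ‖f z.arg - f w.arg‖ ≤ 2 * K * (Real.pi / 2) ^ μ * ‖z - w‖ ^ μ := by
    intro z w hz hw hle
    have ez := Complex.norm_mul_exp_arg_mul_I z
    have ew := Complex.norm_mul_exp_arg_mul_I w
    rw [hz, Complex.ofReal_one, one_mul] at ez
    rw [hw, Complex.ofReal_one, one_mul] at ew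
    have ha := Complex.arg_mem_Ioc z
    have hb := Complex.arg_mem_Ioc w
    set a := z.arg
    set b := w.arg
    have hzw : ‖z - w‖ = ‖Complex.exp (((a - b : ℝ) : ℂ) * Complex.I) - 1‖ := by
      have e : z - w = w * (Complex.exp (((a - b : ℝ) : ℂ) * Complex.I) - 1) := by
        rw [mul_sub, mul_one, Complex.ofReal_sub, sub_mul, Complex.exp_sub, ez, ew,
          mul_div_cancel₀ _ (norm_pos_iff.1 (by rw [hw]; exact one_pos))]
      rw [e, norm_mul, hw, one_mul]
    have hd : ∀ d : ℝ, 0 ≤ d → 2 / Real.pi * d ≤ ‖z - w‖ →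
        2 * (K * d ^ μ) ≤ 2 * K * (Real.pi / 2) ^ μ * ‖z - w‖ ^ μ := by
      intro d hd0 hd
      have h1 : d ≤ Real.pi / 2 * ‖z - w‖ := by
        calc d = Real.pi / 2 * (2 / Real.pi * d) := by field_simp
          _ ≤ _ := by gcongr
      calc 2 * (K * d ^ μ) ≤ 2 * (K * (Real.pi / 2 * ‖z - w‖) ^ μ) := by gcongr
        _ = _ := by rw [Real.mul_rpow (by positivity) (norm_nonneg _)]; ring
    rcases le_or_gt (a - b) Real.pi with hab | hab
    · have h1 := h a ⟨ha.1.le, ha.2⟩ b ⟨hb.1.le, hb.2⟩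
      have h2 := two_div_pi_mul_abs_le_norm_exp_sub_one (θ := a - b)
        (by rwa [abs_of_nonneg (by linarith)])
      rw [← hzw] at h2
      have h3 : 0 ≤ K * |a - b| ^ μ := by positivity
      exact (h1.trans (by linarith)).trans (hd _ (abs_nonneg _) h2)
    · have hper' : Complex.exp (((a - b - 2 * Real.pi : ℝ) : ℂ) * Complex.I) =
          Complex.exp (((a - b : ℝ) : ℂ) * Complex.I) := by
        rw [Complex.ofReal_sub _ (2 * Real.pi), sub_mul]
        push_cast
        exact Complex.exp_periodic.sub_eq _
      have hneg : a - b - 2 * Real.pi ≤ 0 := by linarith [ha.2, hb.1]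
      have h2 := two_div_pi_mul_abs_le_norm_exp_sub_one (θ := a - b - 2 * Real.pi)
        (by rw [abs_of_nonpos hneg]; linarith)
      rw [hper', ← hzw, abs_of_nonpos hneg] at h2
      have h3 := h a ⟨ha.1.le, ha.2⟩ Real.pi ⟨by linarith, le_rfl⟩
      have h4 := h (-Real.pi) ⟨le_rfl, by linarith⟩ b ⟨hb.1.le, hb.2⟩
      rw [hper] at h4
      have d1 : |a - Real.pi| ≤ -(a - b - 2 * Real.pi) := by
        rw [abs_of_nonpos (by linarith [ha.2])]; linarith [hb.1]
      have d2 : |-Real.pi - b| ≤ -(a - b - 2 * Real.pi) := by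
        rw [abs_of_nonpos (by linarith [hb.1])]; linarith [ha.2]
      refine le_trans ?_ (hd _ (by linarith) h2)
      calc ‖f a - f b‖ ≤ ‖f a - f Real.pi‖ + ‖f Real.pi - f b‖ :=
            norm_sub_le_norm_sub_add_norm_sub _ _ _
        _ ≤ K * (-(a - b - 2 * Real.pi)) ^ μ + K * (-(a - b - 2 * Real.pi)) ^ μ := by
            refine add_le_add (h3.trans ?_) (h4.trans ?_) <;> gcongr
        _ = _ := by ring
  intro z w hz hw
  rcases le_total w.arg z.arg with h1 | h1
  · exact hle z w hz hw h1
  · rw [norm_sub_rev, norm_sub_rev z w]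
    exact hle w z hw hz h1

/-! ### Boundary values of the factors on the imaginary axis. -/

theorem one_add_I_mul_tan {x : ℝ} (hx : 0 < Real.cos x) :
    1 + Complex.I * Real.tan x =
      Complex.exp ((-Real.log (Real.cos x) : ℝ) + x * Complex.I) := by
  have hx' : (Real.cos x : ℂ) ≠ 0 := Complex.ofReal_ne_zero.2 hx.ne'
  rw [Complex.exp_add, ← Complex.ofReal_exp, Real.exp_neg, Real.exp_log hx, Complex.exp_mul_I,
    Real.tan_eq_sin_div_cos, ← Complex.ofReal_cos, ← Complex.ofReal_sin]
  push_cast at hx' ⊢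
  field_simp

theorem exp_cpow {r x : ℝ} (h1 : -Real.pi < x) (h2 : x ≤ Real.pi) (κ : ℂ) :
    Complex.exp (r + x * Complex.I) ^ κ = Complex.exp ((r + x * Complex.I) * κ) := by
  rw [Complex.cpow_def_of_ne_zero (Complex.exp_ne_zero _), Complex.log_exp] <;> simpa

theorem I_mul_eq_exp {t : ℝ} (ht : 0 < t) :
    Complex.I * t = Complex.exp ((Real.log t : ℝ) + (Real.pi / 2 : ℝ) * Complex.I) := by
  rw [Complex.exp_add, ← Complex.ofReal_exp, Real.exp_log ht]
  push_cast
  rw [Complex.exp_pi_div_two_mul_I, mul_comm]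

theorem neg_I_mul_eq_exp {t : ℝ} (ht : 0 < t) :
    -Complex.I * t = Complex.exp ((Real.log t : ℝ) + (-(Real.pi / 2) : ℝ) * Complex.I) := by
  rw [Complex.exp_add, ← Complex.ofReal_exp, Real.exp_log ht]
  push_cast
  rw [neg_mul (Real.pi / 2 : ℂ), Complex.exp_neg, Complex.exp_pi_div_two_mul_I, Complex.inv_I,
    mul_comm]

/-- The principal arguments are -π/2 and π/2. For negative t they are interchanged; this change of
sign is the source of the jump at 0. -/
theorem neg_I_mul_cpow_of_pos {t : ℝ} (ht : 0 < t) (η : ℂ) :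
    (-Complex.I * t) ^ η = Complex.exp (-(Real.pi * Complex.I * η)) * (Complex.I * t) ^ η := by
  have := Real.pi_pos
  rw [I_mul_eq_exp ht, neg_I_mul_eq_exp ht, exp_cpow (by linarith) (by linarith),
    exp_cpow (by linarith) (by linarith), ← Complex.exp_add]
  congr 1
  push_cast
  ring

theorem neg_I_mul_cpow_of_neg {t : ℝ} (ht : t < 0) (η : ℂ) :
    (-Complex.I * t) ^ η = Complex.exp (Real.pi * Complex.I * η) * (Complex.I * t) ^ η := by
  have h := neg_I_mul_cpow_of_pos (neg_pos.2 ht) η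
  rw [Complex.ofReal_neg, neg_mul_neg, mul_neg, ← neg_mul Complex.I (t : ℂ)] at h
  rw [h, ← mul_assoc, ← Complex.exp_add, add_neg_cancel, Complex.exp_zero, one_mul]

/-- The boundary values of the two factors on the imaginary axis. -/
theorem powerFactor_boundary {η κ : ℂ} {A B : ℂ → ℂ} {f : ℝ → ℂ}
    (hAB : ∀ z : ℂ, ‖z‖ = 1 → A z + B z⁻¹ = f z.arg) {a : ℝ} (ha : a ∈ Ioo (-Real.pi) Real.pi)
    {c : ℂ} (hc : (-Complex.I * Real.tan (a / 2)) ^ η =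
      Complex.exp c * (Complex.I * Real.tan (a / 2)) ^ η) :
    powerFactor η κ A (-Complex.I * Real.tan (a / 2)) =
      Complex.exp (f a + c - Complex.I * κ * a) *
        powerFactor η κ (fun z => -B z) (Complex.I * Real.tan (a / 2)) := by
  have hcos := cos_half_pos ha
  have hp := one_add_I_mul_tan hcos
  have hm := one_add_I_mul_tan (x := -(a / 2)) (by rwa [Real.cos_neg])
  rw [Real.cos_neg, Real.tan_neg] at hm
  have hm' : 1 + -Complex.I * (Real.tan (a / 2) : ℂ) = Complex.exp
      ((-Real.log (Real.cos (a / 2)) : ℝ) + (-(a / 2) : ℝ) * Complex.I) := by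
    rw [← hm]; push_cast; ring
  have e1 : 1 - -Complex.I * (Real.tan (a / 2) : ℂ) = 1 + Complex.I * Real.tan (a / 2) := by ring
  have e2 : 1 - Complex.I * (Real.tan (a / 2) : ℂ) = 1 + -Complex.I * Real.tan (a / 2) := by ring
  have h1 := ha.1
  have h2 := ha.2
  -- The numbers 1 ± i tan(a/2) have equal modulus and arguments ±a/2: their quotient is the point
  -- e^{ia} of the circle, and their κ-th powers differ by the factor exp(-iκa).
  have hz : (1 + Complex.I * (Real.tan (a / 2) : ℂ)) / (1 + -Complex.I * Real.tan (a / 2)) =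
      Complex.exp (a * Complex.I) := by
    rw [hp, hm', ← Complex.exp_sub]
    congr 1
    push_cast
    ring
  have hz' : (1 + -Complex.I * (Real.tan (a / 2) : ℂ)) / (1 + Complex.I * Real.tan (a / 2)) =
      (Complex.exp (a * Complex.I))⁻¹ := by rw [← hz, inv_div]
  have hA := hAB _ (Complex.norm_exp_ofReal_mul_I a)
  have harg : (Complex.exp (a * Complex.I)).arg = a := by
    rw [Complex.arg_exp_mul_I, toIocMod_eq_self]
    exact ⟨h1, by linarith⟩
  rw [harg] at hA
  rw [powerFactor, powerFactor, e1, e2, hz, hz', hc, hm', hp, exp_cpow (by linarith) (by linarith),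
    exp_cpow (by linarith) (by linarith), ← hA]
  set x := (Complex.I * (Real.tan (a / 2) : ℂ)) ^ η
  set y := A (Complex.exp (a * Complex.I))
  set w := B (Complex.exp (a * Complex.I))⁻¹
  have hgoal : ∀ p q r s v : ℂ, p + q + y = r + s + v →
      Complex.exp p * x * Complex.exp q * Complex.exp y =
      Complex.exp r * (x * Complex.exp s * Complex.exp v) := by
    intro p q r s v h
    have := congrArg (fun b => x * Complex.exp b) h
    simp only [Complex.exp_add] at this
    linear_combination this
  apply hgoal
  push_cast
  ring

/-! ### Rotation of the two half-planes onto the right half-plane. -/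

theorem div_mem_rightHalf_left {u z : ℂ} (hu : u ≠ 0) (hz : z ∈ leftClosed u) :
    z / (Complex.I * u) ∈ rightHalf := by
  refine ⟨div_ne_zero hz.1 (mul_ne_zero Complex.I_ne_zero hu), ?_⟩
  rw [mul_comm, ← div_div, Complex.div_I]
  simpa using hz.2

theorem div_mem_rightHalf_right {u z : ℂ} (hu : u ≠ 0) (hz : z ∈ rightClosed u) :
    z / (-Complex.I * u) ∈ rightHalf := by
  refine ⟨div_ne_zero hz.1 (mul_ne_zero (neg_ne_zero.2 Complex.I_ne_zero) hu), ?_⟩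
  rw [mul_comm, ← div_div, div_neg, Complex.div_I, neg_neg]
  simpa using hz.2

theorem div_re_pos_left {u z : ℂ} (hz : z ∈ leftOpen u) : 0 < (z / (Complex.I * u)).re := by
  rw [mul_comm, ← div_div, Complex.div_I]
  have h : 0 < (z / u).im := hz
  simpa using h

theorem div_re_pos_right {u z : ℂ} (hz : z ∈ rightOpen u) : 0 < (z / (-Complex.I * u)).re := by
  rw [mul_comm, ← div_div, div_neg, Complex.div_I, neg_neg]
  have h : (z / u).im < 0 := hz
  simpa using h

theorem tendsto_div_nhds_zero (c : ℂ) : Tendsto (fun z : ℂ => z / c) (𝓝 0) (𝓝 0) := by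
  simpa using (continuous_id.div_const c).tendsto (0 : ℂ)

theorem tendsto_div_cobounded {c : ℂ} (hc : c ≠ 0) :
    Tendsto (fun z : ℂ => z / c) (Bornology.cobounded ℂ) (Bornology.cobounded ℂ) := by
  rw [← tendsto_norm_atTop_iff_cobounded]
  simp only [norm_div]
  exact tendsto_norm_cobounded_atTop.atTop_div_const (norm_pos_iff.2 hc)

theorem hasBranchFactor_of_tendsto {u : ℂ} (hu : u ≠ 0) {l : Filter ℂ} {α La Lb : ℂ} {P R : ℂ → ℂ}
    (hl : ∀ c : ℂ, c ≠ 0 → Tendsto (fun z : ℂ => z / c) l l) (hLa : La ≠ 0) (hLb : Lb ≠ 0)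
    (hP : Tendsto (fun v => P v / v ^ α) (l ⊓ 𝓟 rightHalf) (𝓝 La))
    (hR : Tendsto (fun v => R v / v ^ α) (l ⊓ 𝓟 rightHalf) (𝓝 Lb)) :
    HasBranchFactor u l α (fun z => P (z / (Complex.I * u))) (fun z => R (z / (-Complex.I * u))) :=
  ⟨⟨La, hLa, hP.comp (Tendsto.inf (hl _ (mul_ne_zero Complex.I_ne_zero hu))
      (tendsto_principal_principal.2 fun _ hz => div_mem_rightHalf_left hu hz))⟩,
    ⟨Lb, hLb, hR.comp (Tendsto.inf (hl _ (mul_ne_zero (neg_ne_zero.2 Complex.I_ne_zero) hu))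
      (tendsto_principal_principal.2 fun _ hz => div_mem_rightHalf_right hu hz))⟩⟩

/-! ### Normalising the logarithms and removing their jumps. -/

/-- This is the freedom that moves Re η₀ by integers; both ends of F₂ shift equally, so the index is
unchanged. -/
theorem IsLogPair.add_int_mul {u : ℂ} {G : ℂ → ℂ} {zeroPlus zeroMinus inftyPlus inftyMinus : ℂ}
    {K μ : ℝ} {F₁ F₂ : ℝ → ℂ} (h : IsLogPair u G zeroPlus zeroMinus inftyPlus inftyMinus K μ F₁ F₂)
    (n : ℤ) : IsLogPair u G zeroPlus zeroMinus inftyPlus inftyMinus K μ F₁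
      (fun a => F₂ a + n * (2 * Real.pi * Complex.I)) where
  holder₁ := h.holder₁
  holder₂ s hs t ht := by
    rw [add_sub_add_right_eq_sub]
    exact h.holder₂ s hs t ht
  exp₁ := h.exp₁
  exp₂ a ha := by rw [Complex.exp_add, Complex.exp_int_mul_two_pi_mul_I, mul_one, h.exp₂ a ha]
  exp_zeroPlus := h.exp_zeroPlus
  exp_zeroMinus := by
    rw [Complex.exp_add, Complex.exp_int_mul_two_pi_mul_I, mul_one, h.exp_zeroMinus]
  exp_inftyMinus := h.exp_inftyMinus
  exp_inftyPlus := by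
    rw [Complex.exp_add, Complex.exp_int_mul_two_pi_mul_I, mul_one, h.exp_inftyPlus]
  index := by
    have := h.index
    simp only [Complex.add_im]
    linarith

/-- The logarithm of the jump that remains after the power factors are split off is Hölder
continuous on the closed interval and takes the same value at both ends. -/
theorem IsLogPair.exists_isHolderOn_remainder {u : ℂ} {G : ℂ → ℂ}
    {zeroPlus zeroMinus inftyPlus inftyMinus : ℂ} {K μ : ℝ} {F₁ F₂ : ℝ → ℂ}
    (h : IsLogPair u G zeroPlus zeroMinus inftyPlus inftyMinus K μ F₁ F₂) (hK : 0 ≤ K)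
    (hμ : 0 < μ) (hμ1 : μ ≤ 1) {η κ : ℂ} (hη : F₂ 0 - F₁ 0 = 2 * Real.pi * Complex.I * η)
    (hκ : F₁ Real.pi - F₂ (-Real.pi) = -(2 * Real.pi * Complex.I * (η + κ))) :
    ∃ (f : ℝ → ℂ) (K' : ℝ), 0 ≤ K' ∧ IsHolderOn K' μ f (Icc (-Real.pi) Real.pi) ∧
      f (-Real.pi) = f Real.pi ∧
      (∀ a, 0 ≤ a → f a = F₁ a + (Real.pi * Complex.I * η + Complex.I * κ * a)) ∧
      (∀ a < 0, f a = F₂ a + (-(Real.pi * Complex.I * η) + Complex.I * κ * a)) := by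
  have hpi := Real.pi_pos
  set f : ℝ → ℂ := fun a => if 0 ≤ a then F₁ a + (Real.pi * Complex.I * η + Complex.I * κ * a)
    else F₂ a + (-(Real.pi * Complex.I * η) + Complex.I * κ * a) with hf
  have hf₁ : ∀ a, 0 ≤ a → f a = F₁ a + (Real.pi * Complex.I * η + Complex.I * κ * a) :=
    fun a ha => if_pos ha
  have hf₂ : ∀ a < 0, f a = F₂ a + (-(Real.pi * Complex.I * η) + Complex.I * κ * a) :=
    fun a ha => if_neg (not_le.2 ha)
  -- The terms ±πiη cancel the jump at a = 0, so both formulas hold there.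
  have hf₂' : ∀ a ≤ 0, f a = F₂ a + (-(Real.pi * Complex.I * η) + Complex.I * κ * a) := by
    intro a ha
    rcases ha.eq_or_lt with rfl | ha
    · rw [hf₁ 0 le_rfl]
      linear_combination -hη
    · exact hf₂ a ha
  set K₀ := K + ‖Complex.I * κ‖ * Real.pi ^ (1 - μ) with hK₀
  have hK₀' : 0 ≤ K₀ := by positivity
  have h₁ : IsHolderOn K₀ μ f (Icc 0 Real.pi) := by
    have := h.holder₁.add (isHolderOn_affine hμ1 (Complex.I * κ) (Real.pi * Complex.I * η)
      (R := Real.pi) fun s hs t ht => abs_le.2 ⟨by linarith [hs.1, ht.2], by linarith [hs.2, ht.1]⟩)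
    intro s hs t ht
    rw [hf₁ s hs.1, hf₁ t ht.1]
    exact this s hs t ht
  have h₂ : IsHolderOn K₀ μ f (Icc (-Real.pi) 0) := by
    have := h.holder₂.add (isHolderOn_affine hμ1 (Complex.I * κ) (-(Real.pi * Complex.I * η))
      (R := Real.pi) fun s hs t ht => abs_le.2 ⟨by linarith [hs.1, ht.2], by linarith [hs.2, ht.1]⟩)
    intro s hs t ht
    rw [hf₂' s hs.2, hf₂' t ht.2]
    exact this s hs t ht
  refine ⟨f, 2 * K₀, by positivity, h₂.union_Icc (by linarith) hpi.le h₁ hK₀' hμ, ?_, hf₁, hf₂⟩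
  -- The linear term contributes 2πiκ between the ends, which together with 2πiη compensates the
  -- jump at infinity.
  rw [hf₁ _ hpi.le, hf₂ _ (neg_lt_zero.2 hpi)]
  push_cast
  linear_combination -hκ

end JumpRH

/-! ### Assembly of the solution. -/

theorem mainTheorem3 (u : ℂ) (hu : ‖u‖ = 1) (G : ℂ → ℂ)
    (zeroPlus zeroMinus inftyPlus inftyMinus : ℂ)
    (hG : JumpRH.IsJumpCoefficient u G zeroPlus zeroMinus inftyPlus inftyMinus)
    (hsymm : zeroPlus - zeroMinus = -(inftyPlus - inftyMinus))
    (hindex : JumpRH.HasZeroIndex u G)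
    (p : JumpRH.SingularPoint) :
    ∃ (η₀ ηinf : ℂ) (Xp Xm : ℂ → ℂ),
      Complex.exp (2 * Real.pi * Complex.I * η₀) = zeroMinus / zeroPlus ∧
      Complex.exp (2 * Real.pi * Complex.I * ηinf) = inftyMinus / inftyPlus ∧
      η₀.re ∈ p.exponentRange ∧ ηinf.re = -η₀.re ∧
      JumpRH.IsSolution u G p Xp Xm ∧
      (∀ z ∈ JumpRH.leftClosed u, Xp z ≠ 0) ∧
      (∀ z ∈ JumpRH.rightClosed u, Xm z ≠ 0) ∧
      JumpRH.HasBranchFactor u (𝓝 0) η₀ Xp Xm ∧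
      JumpRH.HasBranchFactor u (Bornology.cobounded ℂ) (-ηinf) Xp Xm ∧
      ∀ Yp Ym : ℂ → ℂ, JumpRH.IsSolution u G p Yp Ym →
        ∃ c : ℂ, (∀ z ∈ JumpRH.leftClosed u, Yp z = c * Xp z) ∧
          (∀ z ∈ JumpRH.rightClosed u, Ym z = c * Xm z) := by
  open JumpRH in
  have hu0 : u ≠ 0 := norm_pos_iff.1 (by rw [hu]; exact one_pos)
  have hpi := Real.pi_pos
  have h2pi : (2 * Real.pi * Complex.I : ℂ) ≠ 0 := Complex.two_pi_I_ne_zero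
  have hre : ∀ w : ℂ, (w / (2 * Real.pi * Complex.I)).re = w.im / (2 * Real.pi) := by
    intro w
    have e : w / (2 * Real.pi * Complex.I) = w / Complex.I / ((2 * Real.pi : ℝ) : ℂ) := by
      push_cast
      rw [div_div, mul_comm Complex.I]
    rw [e, Complex.div_ofReal_re, Complex.div_I]
    simp
  obtain ⟨K, μ, F₁, F, hK, hμ, hμ1, hF⟩ := exists_isLogPair hG hindex
  obtain ⟨n, hn⟩ := p.exists_add_int_mem ((F 0 - F₁ 0) / (2 * Real.pi * Complex.I)).re
  set F₂ : ℝ → ℂ := fun a => F a + n * (2 * Real.pi * Complex.I) with hF₂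
  have hL : IsLogPair u G zeroPlus zeroMinus inftyPlus inftyMinus K μ F₁ F₂ := hF.add_int_mul n
  set η₀ : ℂ := (F₂ 0 - F₁ 0) / (2 * Real.pi * Complex.I) with hη₀
  set ηinf : ℂ := (F₁ Real.pi - F₂ (-Real.pi)) / (2 * Real.pi * Complex.I) with hηinf
  have e₀ : 2 * Real.pi * Complex.I * η₀ = F₂ 0 - F₁ 0 := mul_div_cancel₀ _ h2pi
  have einf : 2 * Real.pi * Complex.I * ηinf = F₁ Real.pi - F₂ (-Real.pi) := mul_div_cancel₀ _ h2pi
  have hrange : η₀.re ∈ p.exponentRange := by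
    have e : η₀ = (F 0 - F₁ 0) / (2 * Real.pi * Complex.I) + n := by
      rw [hη₀]
      simp only [hF₂]
      field_simp
      ring
    rw [e, Complex.add_re, Complex.intCast_re]
    exact hn
  -- Dividing by 2πi turns imaginary parts into real parts, so this is the index condition on the
  -- four end values.
  have hreinf : ηinf.re = -η₀.re := by
    rw [hη₀, hηinf, hre, hre, ← neg_div]
    congr 1
    have := hL.index
    simp only [Complex.sub_im]
    linarith
  -- The model factor behaves like v^(η₀ + κ) at infinity, so κ is determined by the exponent wanted
  -- there.
  set κ : ℂ := -ηinf - η₀ with hκ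
  have hκre : κ.re = 0 := by simp [hκ, hreinf]
  have hηκ : η₀ + κ = -ηinf := by rw [hκ]; ring
  obtain ⟨f, K', hK', hfH, hfper, hf₁, hf₂⟩ := hL.exists_isHolderOn_remainder hK hμ hμ1 e₀.symm
    (κ := κ) (by rw [hηκ, ← einf]; ring)
  obtain ⟨A, B, hAc, hAd, hBc, hBd, hAB⟩ := (hfH.comp_arg hK' hμ hfper).exists_decomposition
    (by positivity) hμ
  have hBc' := hBc.neg
  have hBd' := hBd.neg
  set P := powerFactor η₀ κ A with hP
  set R := powerFactor η₀ κ (fun z => -B z) with hR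
  have hXp : ∀ z ∈ leftClosed u, P (z / (Complex.I * u)) ≠ 0 := fun z hz =>
    powerFactor_ne_zero _ _ _ (div_mem_rightHalf_left hu0 hz)
  have hXm : ∀ z ∈ rightClosed u, R (z / (-Complex.I * u)) ≠ 0 := fun z hz =>
    powerFactor_ne_zero _ _ _ (div_mem_rightHalf_right hu0 hz)
  obtain ⟨C₁, hC₁, hb₁⟩ := exists_norm_powerFactor_bounds η₀ hκre hAc
  obtain ⟨C₂, hC₂, hb₂⟩ := exists_norm_powerFactor_bounds η₀ hκre hBc'
  have hnl : ∀ z : ℂ, ‖z / (Complex.I * u)‖ = ‖z‖ := fun z => by simp [hu]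
  have hnr : ∀ z : ℂ, ‖z / (-Complex.I * u)‖ = ‖z‖ := fun z => by simp [hu]
  set C := max C₁ C₂ with hC
  have hpow : ∀ z : ℂ, z ≠ 0 → 0 < ‖z‖ ^ η₀.re := fun z hz =>
    Real.rpow_pos_of_pos (norm_pos_iff.2 hz) _
  have hupp : ∀ z ∈ leftClosed u, ‖P (z / (Complex.I * u))‖ ≤ C * ‖z‖ ^ η₀.re := fun z hz => by
    have h1 := (hb₁ _ (div_mem_rightHalf_left hu0 hz)).1
    rw [hnl] at h1
    exact h1.trans (mul_le_mul_of_nonneg_right (le_max_left _ _) (hpow z hz.1).le)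
  have hupm : ∀ z ∈ rightClosed u, ‖R (z / (-Complex.I * u))‖ ≤ C * ‖z‖ ^ η₀.re := fun z hz => by
    have h1 := (hb₂ _ (div_mem_rightHalf_right hu0 hz)).1
    rw [hnr] at h1
    exact h1.trans (mul_le_mul_of_nonneg_right (le_max_right _ _) (hpow z hz.1).le)
  have hlop : ∀ z ∈ leftClosed u, ‖z‖ ^ η₀.re ≤ C * ‖P (z / (Complex.I * u))‖ := fun z hz => by
    have h1 := (hb₁ _ (div_mem_rightHalf_left hu0 hz)).2
    rw [hnl] at h1
    exact h1.trans (mul_le_mul_of_nonneg_right (le_max_left _ _) (norm_nonneg _))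
  have hlom : ∀ z ∈ rightClosed u, ‖z‖ ^ η₀.re ≤ C * ‖R (z / (-Complex.I * u))‖ := fun z hz => by
    have h1 := (hb₂ _ (div_mem_rightHalf_right hu0 hz)).2
    rw [hnr] at h1
    exact h1.trans (mul_le_mul_of_nonneg_right (le_max_right _ _) (norm_nonneg _))
  have hbdry : ∀ t : ℝ, t ≠ 0 → P (t * u / (Complex.I * u)) =
      G (t * u) * R (t * u / (-Complex.I * u)) := by
    intro t ht
    have e1 : t * u / (Complex.I * u) = -Complex.I * t := by
      rw [mul_div_mul_right _ _ hu0, Complex.div_I]; ring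
    have e2 : t * u / (-Complex.I * u) = Complex.I * t := by
      rw [mul_div_mul_right _ _ hu0, div_neg, Complex.div_I]; ring
    rw [e1, e2]
    set a := 2 * Real.arctan t with ha
    have hta : Real.tan (a / 2) = t := by
      rw [ha, mul_div_cancel_left₀ _ two_ne_zero, Real.tan_arctan]
    have ham : a ∈ Set.Ioo (-Real.pi) Real.pi :=
      ⟨by linarith [Real.neg_pi_div_two_lt_arctan t], by linarith [Real.arctan_lt_pi_div_two t]⟩
    rcases lt_or_gt_of_ne ht with ht | ht
    · have ha0 : a < 0 := by
        have := Real.arctan_lt_zero.2 ht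
        linarith
      -- This c and the term -iκa undo the corrections built into f, leaving exp(F₂ a) = G.
      have hb := powerFactor_boundary (κ := κ) hAB ham
        (c := Real.pi * Complex.I * η₀) (by rw [hta]; exact neg_I_mul_cpow_of_neg ht η₀)
      rw [hf₂ a ha0, hta] at hb
      rw [hP, hb, hR, ← hta, ← hL.exp₂ a ⟨ham.1, ha0⟩]
      congr 2
      ring
    · have ha0 : 0 < a := by
        have := Real.arctan_pos.2 ht
        linarith
      have hb := powerFactor_boundary (κ := κ) hAB ham
        (c := -(Real.pi * Complex.I * η₀)) (by rw [hta]; exact neg_I_mul_cpow_of_pos ht η₀)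
      rw [hf₁ a ha0.le, hta] at hb
      rw [hP, hb, hR, ← hta, ← hL.exp₁ a ⟨ha0, ham.2⟩]
      congr 2
      ring
  have hsol : IsSolution u G p (fun z => P (z / (Complex.I * u)))
      (fun z => R (z / (-Complex.I * u))) := by
    refine ⟨?_, ?_, ?_, ?_, hbdry, ?_⟩
    · exact (differentiableOn_powerFactor η₀ κ hAd).comp (by fun_prop) fun z hz =>
        div_re_pos_left hz
    · exact (differentiableOn_powerFactor η₀ κ hBd').comp (by fun_prop) fun z hz =>
        div_re_pos_right hz
    · exact (continuousOn_powerFactor η₀ κ hAc).comp (by fun_prop) fun z hz =>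
        div_mem_rightHalf_left hu0 hz
    · exact (continuousOn_powerFactor η₀ κ hBc').comp (by fun_prop) fun z hz =>
        div_mem_rightHalf_right hu0 hz
    · obtain ⟨η, h0, h1, hη⟩ := p.exists_growthExponent_eq hrange
      -- The growth condition is strict, whence C + 1.
      refine ⟨C + 1, η, h0, h1, fun z hz => ?_, fun z hz => ?_⟩
      · rw [p.div_norm_coord_rpow, hη]
        exact (hupp z hz).trans_lt (mul_lt_mul_of_pos_right (lt_add_one C) (hpow z hz.1))
      · rw [p.div_norm_coord_rpow, hη]
        exact (hupm z hz).trans_lt (mul_lt_mul_of_pos_right (lt_add_one C) (hpow z hz.1))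
  refine ⟨η₀, ηinf, _, _, ?_, ?_, hrange, hreinf, hsol, hXp, hXm, ?_, ?_, ?_⟩
  · rw [e₀, Complex.exp_sub, hL.exp_zeroMinus, hL.exp_zeroPlus]
  · rw [einf, Complex.exp_sub, hL.exp_inftyMinus, hL.exp_inftyPlus]
  · exact hasBranchFactor_of_tendsto hu0 (fun c _ => tendsto_div_nhds_zero c)
      (Complex.exp_ne_zero _) (Complex.exp_ne_zero _)
      (tendsto_powerFactor_zero η₀ κ hAc) (tendsto_powerFactor_zero η₀ κ hBc')
  · rw [← hηκ]
    exact hasBranchFactor_of_tendsto hu0 (fun c hc => tendsto_div_cobounded hc)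
      (Complex.exp_ne_zero _) (Complex.exp_ne_zero _)
      (tendsto_powerFactor_cobounded η₀ κ hAc) (tendsto_powerFactor_cobounded η₀ κ hBc')
  · intro Yp Ym hY
    exact hsol.exists_eq_const_mul hu hY hG.ne_zero hXp hXm hrange hlop hlom
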